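/- Let $n\ge 1$ and let $u:[0,\infty)\to\mathbb R^n$ be bounded and uniformly continuous (for instance, bounded and differentiable with bounded derivative). Consider the system $\dot x=u(t)$, $x(t)\in\mathbb R^n$, with measured output $y=\tfrac12|x|^2$. With the augmented state $X=[x^\top,y]^\top\in\mathbb R^{n+1}$ it satisfies $\dot X=A(t)X+\bar u(t)$, $y=CX$, where $$A(t)=\begin{bmatrix}0_{n\times n}&0_{n\times 1}\\u^\top(t)&0\end{bmatrix},\qquad C=\begin{bmatrix}0_{1\times n}&1\end{bmatrix},\qquad \bar u=\begin{bmatrix}u\\0\end{bmatrix}.$$ Let $\epsilon>0$, let $P_0$ be a symmetric positive definite $(n+1)\times(n+1)$ matrix, and let $k,q:[0,\infty)\to\mathbb R$ and the symmetric-matrix-valued function $V$ on $[0,\infty)$ be continuous, with $q$ and $V$ bounded and $k(t)\ge\tfrac12$, $q(t)\ge\epsilon$, $V(t)\ge\epsilon I$ for all $t\ge0$. Consider the Riccati observer $$\dot{\hat X}=A(t)\hat X+\bar u+K(t)(y-C\hat X),\qquad K(t)=k(t)P(t)C^\top q(t),$$ $$\dot P=A(t)P+PA^\top(t)-PC^\top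 q(t)CP+V(t),\qquad P(0)=P_0 .$$ If there are $\delta>0$ and $\mu>0$ such that $$\frac1\delta\int_t^{t+\delta}u(s)u^\top(s)\,ds\ \ge\ \mu I\qquad\text{for all }t\ge0,$$ then the Riccati equation has a solution $P$ on $[0,\infty)$, and for this solution the observer globally exponentially stabilizes the estimation error $\tilde X=X-\hat X$ at $0$: for all $x(0)\in\mathbb R^n$ and $\hat X(0)\in\mathbb R^{n+1}$ the system and the observer have solutions on $[0,\infty)$, and there are constants $c,r>0$, independent of $x(0)$ and $\hat X(0)$, such that every such pair of solutions satisfies $$|\tilde X(t)|\le c\,e^{-r(t-t_0)}\,|\tilde X(t_0)|\qquad\text{for all }t\ge t_0\ge 0 .$$ -/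

import Mathlib

open Set Matrix MeasureTheory

noncomputable section

/-- Index set of the augmented state `X = [xᵀ, y]ᵀ ∈ ℝⁿ⁺¹`: the left summand indexes `x`, the right
summand is the single index of `y`. -/
abbrev AugIdx (n : ℕ) : Type := Fin n ⊕ Unit

/-- Persistent excitation with constants `δ`, `μ`: for every `t ≥ 0`,
`(1/δ) ∫_t^{t+δ} u(s) u(s)ᵀ ds ≥ μ I` in the order of symmetric matrices (the integral of the
matrix-valued function is taken entrywise). -/
def PersistentlyExciting {n : ℕ} (u : ℝ → EuclideanSpace ℝ (Fin n)) (δ μ : ℝ) : Prop :=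
  ∀ t : ℝ, 0 ≤ t →
    (((1 / δ) • (Matrix.of fun i j : Fin n => ∫ s in t..(t + δ), u s i * u s j))
      - μ • (1 : Matrix (Fin n) (Fin n) ℝ)).PosSemidef

/-- The range output `y = ½ |x|²`. -/
def rangeOutput {n : ℕ} (x : EuclideanSpace ℝ (Fin n)) : ℝ := (1 / 2) * ‖x‖ ^ 2

/-- The augmented state `X = [xᵀ, y]ᵀ` with `y = ½ |x|²`. -/
def augState {n : ℕ} (x : EuclideanSpace ℝ (Fin n)) : EuclideanSpace ℝ (AugIdx n) :=
  WithLp.toLp 2 (Sum.elim (fun i => x i) (fun _ => rangeOutput x))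

/-- The augmented input `ū = [uᵀ, 0]ᵀ`. -/
def augInput {n : ℕ} (v : EuclideanSpace ℝ (Fin n)) : AugIdx n → ℝ :=
  Sum.elim (fun i => v i) (fun _ => 0)

/-- The state matrix `A = [[0, 0], [uᵀ, 0]]` for the current value `v` of the input. -/
def stateMatrix {n : ℕ} (v : EuclideanSpace ℝ (Fin n)) : Matrix (AugIdx n) (AugIdx n) ℝ :=
  Matrix.fromBlocks 0 0 (Matrix.of fun _ j => v j) 0

/-- The output matrix `C = [0, 1]`. -/
def outputMatrix (n : ℕ) : Matrix Unit (AugIdx n) ℝ :=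
  Matrix.fromCols 0 1

/-- `P` solves the continuous Riccati equation
`Ṗ = A P + P Aᵀ - P Cᵀ q C P + V` on `[0, ∞)` (entrywise) with `P(0) = P₀`. -/
def IsRiccatiSolution {n : ℕ} (u : ℝ → EuclideanSpace ℝ (Fin n)) (q : ℝ → ℝ)
    (V : ℝ → Matrix (AugIdx n) (AugIdx n) ℝ) (P₀ : Matrix (AugIdx n) (AugIdx n) ℝ)
    (P : ℝ → Matrix (AugIdx n) (AugIdx n) ℝ) : Prop :=
  P 0 = P₀ ∧ ∀ t : ℝ, 0 ≤ t → ∀ i j : AugIdx n,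
    HasDerivWithinAt (fun s => P s i j)
      ((stateMatrix (u t) * P t + P t * (stateMatrix (u t))ᵀ
        - P t * (outputMatrix n)ᵀ * (q t • outputMatrix n) * P t + V t) i j) (Ici 0) t

/-- The observer gain `K = k P Cᵀ q`, for the current values of `k`, `q` and `P`. -/
def observerGain {n : ℕ} (k q : ℝ) (P : Matrix (AugIdx n) (AugIdx n) ℝ) :
    Matrix (AugIdx n) Unit ℝ :=
  (k * q) • (P * (outputMatrix n)ᵀ)

/-- `x` is a trajectory of the measured system: `ẋ = u` on `[0, ∞)`. -/
def IsPositionTrajectory {n : ℕ} (u x : ℝ → EuclideanSpace ℝ (Fin n)) : Prop :=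
  ∀ t : ℝ, 0 ≤ t → HasDerivWithinAt x (u t) (Ici 0) t

/-- `X'` is a trajectory on `[0, ∞)` of the observer fed with the velocity `u` and with the
measurement `y = ½ |x|²` of the position trajectory `x`:
`dX'/dt = A X' + ū + K (y - C X')`. -/
def IsObserverTrajectory {n : ℕ} (u : ℝ → EuclideanSpace ℝ (Fin n)) (q k : ℝ → ℝ)
    (P : ℝ → Matrix (AugIdx n) (AugIdx n) ℝ) (x : ℝ → EuclideanSpace ℝ (Fin n))
    (X' : ℝ → EuclideanSpace ℝ (AugIdx n)) : Prop :=
  ∀ t : ℝ, 0 ≤ t →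
    HasDerivWithinAt X'
      (WithLp.toLp 2
        (stateMatrix (u t) *ᵥ (X' t).ofLp + augInput (u t)
          + observerGain (k t) (q t) (P t) *ᵥ
              ((fun _ : Unit => rangeOutput (x t)) - outputMatrix n *ᵥ (X' t).ofLp)))
      (Ici 0) t

/-- The observer with Riccati matrix `P` globally exponentially stabilizes the estimation error
`X - X'` at zero: from all initial positions and initial estimates there are system and observer
trajectories defined on `[0, ∞)`, and the error of all such trajectories satisfies
`|X(t) - X'(t)| ≤ c e^{-r (t - t₀)} |X(t₀) - X'(t₀)|` for all `t ≥ t₀ ≥ 0`, with positive constants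
`c`, `r` that do not depend on the trajectories nor on `t₀`. -/
def GloballyExponentiallyStabilizes {n : ℕ} (u : ℝ → EuclideanSpace ℝ (Fin n)) (q k : ℝ → ℝ)
    (P : ℝ → Matrix (AugIdx n) (AugIdx n) ℝ) : Prop :=
  (∀ (x₀ : EuclideanSpace ℝ (Fin n)) (X₀ : EuclideanSpace ℝ (AugIdx n)),
    ∃ (x : ℝ → EuclideanSpace ℝ (Fin n)) (X' : ℝ → EuclideanSpace ℝ (AugIdx n)),
      x 0 = x₀ ∧ X' 0 = X₀ ∧ IsPositionTrajectory u x ∧ IsObserverTrajectory u q k P x X') ∧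
  ∃ c r : ℝ, 0 < c ∧ 0 < r ∧
    ∀ (x : ℝ → EuclideanSpace ℝ (Fin n)) (X' : ℝ → EuclideanSpace ℝ (AugIdx n)),
      IsPositionTrajectory u x → IsObserverTrajectory u q k P x X' →
      ∀ t₀ t : ℝ, 0 ≤ t₀ → t₀ ≤ t →
        ‖augState (x t) - X' t‖ ≤ c * Real.exp (-r * (t - t₀)) * ‖augState (x t₀) - X' t₀‖

end

/-! Since `y = ½|x|²` has derivative `u · x`, the augmented error `e = X - X'` obeys the linear
equation `e' = (A - K C) e`. With `Q = P⁻¹`, the gain cancels against `Q` in the derivative of `eᵀ Q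
e`, which is `(1 - 2k) q (C e)² - (Q e)ᵀ V (Q e)`. The first term is nonpositive because `k ≥ 1/2`,
so exponential decay follows once `α I ≤ Q ≤ β I` uniformly in time (`observer_error_bound`).

The upper bound on `Q`, that is `P ≥ p I`, needs no excitation: where `P` would touch a small
multiple of `I`, the term `V` pushes it back (`riccati_lower_bound`).

The lower bound on `Q` uses excitation. The equation `Q' = CᵀqC - Q A - Aᵀ Q - Q V Q` is compared
with the linear one `R' = CᵀC - R - R A - Aᵀ R`, `R(0) = I`: for small `η` the forgetting term `-R`
dominates `Q V Q` where `Q` would touch `η R` (`information_lower_bound`). Along `z' = A z` with `z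
= (x, η)`, the vector `x` is constant, `η' = u · x`, and `exp s * zᵀ R z` has derivative `exp s *
η²`. Excitation makes `|u · x|` comparable to `|x|` somewhere in every window, and uniform
continuity keeps it so for a fixed duration. Hence `η` cannot stay small, and the energy controls
`|x|` and `η` (`energy_lower_bound`, `lyapunov_lower_bound`).

All matrix comparisons go through the first-contact argument `posDef_of_barrier`. Global existence
of `P` comes from the linear Hamiltonian system (`exists_riccati_solution`). -/

/-! ### Global solutions of linear differential equations. -/

/-- A linear differential equation with continuous coefficients has a solution on `[0, ∞)`. -/
theorem exists_forall_hasDerivAt_linear {E : Type*} [NormedAddCommGroup E] [NormedSpace ℝ E]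
    [CompleteSpace E] {L : ℝ → E →L[ℝ] E} {b : ℝ → E} (hL : Continuous L) (hb : Continuous b)
    (x₀ : E) :
    ∃ x : ℝ → E, x 0 = x₀ ∧ ∀ t : ℝ, 0 ≤ t → HasDerivAt x (L t (x t) + b t) t := by
  let k : ℝ → ℝ := fun t => ‖L t‖ + ‖b t‖
  have hk : Continuous k := hL.norm.add hb.norm
  have hk0 : ∀ t, 0 ≤ k t := fun t => by positivity
  -- Weighted Picard iteration for `y = w⁻¹ • x`: the factor `2` gives `∫ k w = (w - 1) / 2`, hence
  -- contraction ratio `1/2` on the whole half-line at once. Including `‖b‖` in `k` keeps the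
  -- forcing bounded relative to `w`.
  let w : ℝ → ℝ := fun t => Real.exp (2 * ∫ s in (0 : ℝ)..t, k s)
  have hw0 : ∀ t, 0 < w t := fun t => Real.exp_pos _
  have hwd : ∀ t, HasDerivAt w (2 * (k t * w t)) t := fun t => by
    have h := ((hk.integral_hasStrictDerivAt 0 t).hasDerivAt.const_mul 2).exp
    convert h using 1
    simp only [w]; ring
  have hwc : Continuous w := continuous_iff_continuousAt.2 fun t => (hwd t).continuousAt
  have hw00 : w 0 = 1 := by simp [w]
  have hw1 : ∀ t, 0 ≤ t → 1 ≤ w t := fun t ht => by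
    refine Real.one_le_exp ?_
    have := intervalIntegral.integral_nonneg (μ := volume) ht (fun s _ => hk0 s)
    positivity
  have hwi : ∀ t, ∫ s in (0 : ℝ)..t, k s * w s = (w t - 1) / 2 := fun t => by
    have h := intervalIntegral.integral_eq_sub_of_hasDerivAt (a := 0) (b := t)
      (fun s _ => hwd s) ((continuous_const.mul (hk.mul hwc)).intervalIntegrable _ _)
    rw [intervalIntegral.integral_const_mul, hw00] at h
    linarith
  let F : BoundedContinuousFunction ℝ E → ℝ → E := fun y s => L s (w s • y s) + b s
  have hF : ∀ y, Continuous (F y) := fun y =>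
    (hL.clm_apply (hwc.smul y.continuous)).add hb
  let I : BoundedContinuousFunction ℝ E → ℝ → E := fun y t => x₀ + ∫ s in (0 : ℝ)..t, F y s
  have hId : ∀ y t, HasDerivAt (I y) (F y t) t := fun y t =>
    ((hF y).integral_hasStrictDerivAt 0 t).hasDerivAt.const_add x₀
  have hIc : ∀ y, Continuous (I y) := fun y =>
    continuous_iff_continuousAt.2 fun t => (hId y t).continuousAt
  have key : ∀ (G : ℝ → E) (C : ℝ), (∀ s, 0 ≤ s → ‖G s‖ ≤ k s * w s * C) → ∀ t, 0 ≤ t →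
      ‖∫ s in (0 : ℝ)..t, G s‖ ≤ (w t - 1) / 2 * C := fun G C hG t ht => by
    rw [← hwi, ← intervalIntegral.integral_mul_const]
    refine intervalIntegral.norm_integral_le_of_norm_le ht ?_
      (((hk.mul hwc).mul continuous_const).intervalIntegrable _ _)
    exact Filter.Eventually.of_forall fun s hs => hG s hs.1.le
  have hIb : ∀ y t, 0 ≤ t → ‖I y t‖ ≤ w t * (‖x₀‖ + (‖y‖ + 1)) := fun y t ht => by
    have h1 := key (F y) (‖y‖ + 1) (fun s hs => by
      have e1 : ‖L s (w s • y s)‖ ≤ ‖L s‖ * (w s * ‖y‖) := by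
        refine (L s).le_opNorm_of_le ?_
        rw [norm_smul, Real.norm_of_nonneg (hw0 s).le]
        exact mul_le_mul_of_nonneg_left (y.norm_coe_le_norm s) (hw0 s).le
      have e2 := norm_add_le (L s (w s • y s)) (b s)
      have e3 := mul_le_mul_of_nonneg_left (hw1 s hs) (norm_nonneg (b s))
      have e4 : 0 ≤ ‖L s‖ * w s := mul_nonneg (norm_nonneg _) (hw0 s).le
      have e5 : 0 ≤ ‖b s‖ * w s * ‖y‖ :=
        mul_nonneg (mul_nonneg (norm_nonneg _) (hw0 s).le) (norm_nonneg _)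
      simp only [F, k]
      nlinarith) t ht
    have h2 := norm_add_le x₀ (∫ s in (0 : ℝ)..t, F y s)
    have h3 := hw1 t ht
    have h4 := mul_le_mul_of_nonneg_right h3 (norm_nonneg x₀)
    have h5 : 0 ≤ (w t + 1) * (‖y‖ + 1) := by positivity
    simp only [I]
    nlinarith
  -- Freezing the value at negative times gives a bounded continuous function on all of `ℝ`; only `t
  -- ≥ 0` matters.
  let S : BoundedContinuousFunction ℝ E → BoundedContinuousFunction ℝ E := fun y =>
    BoundedContinuousFunction.ofNormedAddCommGroup (fun t => (w (max t 0))⁻¹ • I y (max t 0))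
      (((hwc.inv₀ fun t => (hw0 t).ne').smul (hIc y)).comp (continuous_id.max continuous_const))
      (‖x₀‖ + (‖y‖ + 1)) (fun t => by
        rw [norm_smul, norm_inv, Real.norm_of_nonneg (hw0 _).le, inv_mul_le_iff₀ (hw0 _)]
        exact hIb y _ (le_max_right _ _))
  have hS : ContractingWith (1 / 2) S := by
    refine ⟨by norm_num [← NNReal.coe_lt_coe], LipschitzWith.of_dist_le_mul fun y z => ?_⟩
    refine (BoundedContinuousFunction.dist_le (by positivity)).2 fun t => ?_
    have ht : 0 ≤ max t 0 := le_max_right _ _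
    change dist ((w (max t 0))⁻¹ • I y (max t 0)) ((w (max t 0))⁻¹ • I z (max t 0)) ≤ _
    generalize max t 0 = r at ht
    have e : I y r - I z r = ∫ s in (0 : ℝ)..r, (F y s - F z s) := by
      rw [intervalIntegral.integral_sub ((hF y).intervalIntegrable _ _)
        ((hF z).intervalIntegrable _ _)]
      simp [I]
    rw [dist_eq_norm, ← smul_sub, norm_smul, norm_inv, Real.norm_of_nonneg (hw0 _).le,
      inv_mul_le_iff₀ (hw0 _), e, dist_eq_norm]
    refine (key _ ‖y - z‖ (fun s hs => ?_) r ht).trans ?_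
    · have e1 : F y s - F z s = L s (w s • (y - z) s) := by
        simp [F, smul_sub, map_sub]
      rw [e1]
      have e2 : ‖L s (w s • (y - z) s)‖ ≤ ‖L s‖ * (w s * ‖y - z‖) := by
        refine (L s).le_opNorm_of_le ?_
        rw [norm_smul, Real.norm_of_nonneg (hw0 s).le]
        exact mul_le_mul_of_nonneg_left ((y - z).norm_coe_le_norm s) (hw0 s).le
      refine e2.trans ?_
      rw [← mul_assoc]
      have := norm_nonneg (b s)
      have := (hw0 s).le
      gcongr
      simp only [k]; linarith
    · have := norm_nonneg (y - z)
      push_cast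
      nlinarith
  let y := hS.fixedPoint S
  have hy : ∀ t, 0 ≤ t → w t • y t = I y t := fun t ht => by
    have h : S y t = y t := by rw [show S y = y from hS.fixedPoint_isFixedPt]
    have h' : S y t = (w (max t 0))⁻¹ • I y (max t 0) := rfl
    rw [← h, h', max_eq_left ht, smul_inv_smul₀ (hw0 t).ne']
  refine ⟨I y, by simp [I], fun t ht => ?_⟩
  rw [← hy t ht]
  exact hId y t

theorem exists_forall_hasDerivWithinAt_linear {E : Type*} [NormedAddCommGroup E]
    [NormedSpace ℝ E] [CompleteSpace E] {L : ℝ → E →L[ℝ] E} {b : ℝ → E}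
    (hL : ContinuousOn L (Ici 0)) (hb : ContinuousOn b (Ici 0)) (x₀ : E) :
    ∃ x : ℝ → E, x 0 = x₀ ∧ ∀ t : ℝ, 0 ≤ t →
      HasDerivWithinAt x (L t (x t) + b t) (Ici 0) t := by
  have hm : Continuous fun t : ℝ => max t 0 := continuous_id.max continuous_const
  obtain ⟨x, hx0, hx⟩ := exists_forall_hasDerivAt_linear
    (hL.comp_continuous hm fun t => le_max_right t 0)
    (hb.comp_continuous hm fun t => le_max_right t 0) x₀
  refine ⟨x, hx0, fun t ht => ?_⟩
  have h := (hx t ht).hasDerivWithinAt (s := Ici 0)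
  simpa only [Function.comp_apply, max_eq_left ht] using h

/-! ### Calculus of matrix functions and the barrier principle. -/

section MatrixCalculus

open scoped Matrix.Norms.Operator

variable {m : Type*} [Fintype m]

theorem hasDerivWithinAt_matrix_iff {M : ℝ → Matrix m m ℝ} {M' : Matrix m m ℝ} {s : Set ℝ}
    {t : ℝ} : HasDerivWithinAt M M' s t ↔
      ∀ i j, HasDerivWithinAt (fun r => M r i j) (M' i j) s t :=
  ⟨fun h i j => hasDerivWithinAt_pi.1 (hasDerivWithinAt_pi.1 h i) j,
    fun h => hasDerivWithinAt_pi.2 fun i => hasDerivWithinAt_pi.2 fun j => h i j⟩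

theorem HasDerivWithinAt.matrix_transpose {M : ℝ → Matrix m m ℝ} {M' : Matrix m m ℝ} {s : Set ℝ}
    {t : ℝ} (h : HasDerivWithinAt M M' s t) : HasDerivWithinAt (fun r => (M r)ᵀ) M'ᵀ s t :=
  hasDerivWithinAt_matrix_iff.2 fun i j => hasDerivWithinAt_matrix_iff.1 h j i

theorem HasDerivWithinAt.mulVec {M : ℝ → Matrix m m ℝ} {M' : Matrix m m ℝ} {v : ℝ → m → ℝ}
    {v' : m → ℝ} {s : Set ℝ} {t : ℝ} (hM : HasDerivWithinAt M M' s t)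
    (hv : HasDerivWithinAt v v' s t) :
    HasDerivWithinAt (fun r => M r *ᵥ v r) (M' *ᵥ v t + M t *ᵥ v') s t := by
  refine hasDerivWithinAt_pi.2 fun i => ?_
  have h := HasDerivWithinAt.fun_sum (u := Finset.univ) fun j _ =>
    (hasDerivWithinAt_matrix_iff.1 hM i j).fun_mul (hasDerivWithinAt_pi.1 hv j)
  refine h.congr_deriv ?_
  simp only [Pi.add_apply, Matrix.mulVec, dotProduct, ← Finset.sum_add_distrib]

theorem HasDerivWithinAt.dotProduct {v w : ℝ → m → ℝ} {v' w' : m → ℝ} {s : Set ℝ} {t : ℝ}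
    (hv : HasDerivWithinAt v v' s t) (hw : HasDerivWithinAt w w' s t) :
    HasDerivWithinAt (fun r => v r ⬝ᵥ w r) (v' ⬝ᵥ w t + v t ⬝ᵥ w') s t := by
  have h := HasDerivWithinAt.fun_sum (u := Finset.univ) fun j _ =>
    (hasDerivWithinAt_pi.1 hv j).fun_mul (hasDerivWithinAt_pi.1 hw j)
  refine h.congr_deriv ?_
  simp only [_root_.dotProduct, ← Finset.sum_add_distrib]

theorem HasDerivWithinAt.quadForm {M : ℝ → Matrix m m ℝ} {M' : Matrix m m ℝ} {v : ℝ → m → ℝ}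
    {v' : m → ℝ} {s : Set ℝ} {t : ℝ} (hM : HasDerivWithinAt M M' s t)
    (hv : HasDerivWithinAt v v' s t) (hs : (M t)ᵀ = M t) :
    HasDerivWithinAt (fun r => v r ⬝ᵥ M r *ᵥ v r)
      (v t ⬝ᵥ M' *ᵥ v t + 2 * (v t ⬝ᵥ M t *ᵥ v')) s t := by
  refine (hv.dotProduct (hM.mulVec hv)).congr_deriv ?_
  have : v' ⬝ᵥ M t *ᵥ v t = v t ⬝ᵥ M t *ᵥ v' := by
    rw [dotProduct_comm, dotProduct_mulVec, ← hs, vecMul_transpose, hs]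
  rw [dotProduct_add, this]
  ring

theorem continuousOn_quadForm {M : ℝ → Matrix m m ℝ} {s : Set ℝ} (hM : ContinuousOn M s) :
    ContinuousOn (fun p : ℝ × (m → ℝ) => p.2 ⬝ᵥ M p.1 *ᵥ p.2) (s ×ˢ univ) := by
  have h1 : ContinuousOn (fun p : ℝ × (m → ℝ) => M p.1) (s ×ˢ univ) :=
    hM.comp continuousOn_fst fun p hp => hp.1
  have h2 : ∀ i j, ContinuousOn (fun p : ℝ × (m → ℝ) => M p.1 i j) (s ×ˢ univ) := fun i j =>
    continuousOn_pi.1 (continuousOn_pi.1 h1 i) j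
  have h3 : ∀ i, ContinuousOn (fun p : ℝ × (m → ℝ) => p.2 i) (s ×ˢ univ) := fun i =>
    ((continuous_apply i).comp continuous_snd).continuousOn
  simp only [dotProduct, Matrix.mulVec]
  exact continuousOn_finsetSum _ fun i _ => (h3 i).mul
    (continuousOn_finsetSum _ fun j _ => (h2 i j).mul (h3 j))

theorem posDef_iff_real {M : Matrix m m ℝ} (hs : Mᵀ = M) :
    M.PosDef ↔ ∀ v : m → ℝ, v ≠ 0 → 0 < v ⬝ᵥ M *ᵥ v :=
  ⟨fun h v hv => by simpa using h.dotProduct_mulVec_pos hv, fun h =>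
    PosDef.of_dotProduct_mulVec_pos (by simpa [IsHermitian] using hs) fun v hv => by
      simpa using h v hv⟩

/-- A symmetric matrix function that starts positive definite stays so if its quadratic form
strictly increases at all vectors of the kernel whenever it is positive semidefinite. -/
theorem posDef_of_barrier {D D' : ℝ → Matrix m m ℝ} (hsymm : ∀ t, 0 ≤ t → (D t)ᵀ = D t)
    (hD : ∀ t, 0 ≤ t → HasDerivWithinAt D (D' t) (Ici 0) t) (h0 : (D 0).PosDef)
    (hpos : ∀ t, 0 ≤ t → ∀ v : m → ℝ, v ≠ 0 → (∀ w : m → ℝ, 0 ≤ w ⬝ᵥ D t *ᵥ w) →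
      D t *ᵥ v = 0 → 0 < v ⬝ᵥ D' t *ᵥ v) (t : ℝ) (ht : 0 ≤ t) : (D t).PosDef := by
  rw [posDef_iff_real (hsymm t ht)]
  by_contra! hcon
  obtain ⟨v, hv, hvt⟩ := hcon
  have hDc : ContinuousOn D (Ici 0) := fun s hs => (hD s hs).continuousWithinAt
  have hqc := continuousOn_quadForm hDc
  -- Compactness of `Z` gives a first failure time. There the matrix is still positive semidefinite,
  -- so the failing vector lies in its kernel; its form was positive before and vanishes now,
  -- against the positive derivative.
  let Z : Set (ℝ × (m → ℝ)) :=
    (Icc 0 t ×ˢ Metric.sphere 0 1) ∩ (fun p : ℝ × (m → ℝ) => p.2 ⬝ᵥ D p.1 *ᵥ p.2) ⁻¹' Iic 0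
  have hZ : IsCompact Z := by
    have hK : IsCompact (Icc 0 t ×ˢ Metric.sphere (0 : m → ℝ) 1) :=
      isCompact_Icc.prod (isCompact_sphere _ _)
    refine hK.of_isClosed_subset ?_ inter_subset_left
    exact (hqc.mono (prod_mono Icc_subset_Ici_self (subset_univ _))).preimage_isClosed_of_isClosed
      hK.isClosed isClosed_Iic
  have hmem : ∀ s ∈ Icc 0 t, ∀ w : m → ℝ, w ≠ 0 → w ⬝ᵥ D s *ᵥ w ≤ 0 → s ∈ Prod.fst '' Z := by
    intro s hs w hw hws
    refine ⟨(s, ‖w‖⁻¹ • w), ⟨⟨hs, ?_⟩, ?_⟩, rfl⟩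
    · simp [norm_smul, hw]
    · simp only [mem_preimage, mem_Iic, mulVec_smul, dotProduct_smul, smul_dotProduct, smul_eq_mul]
      have : 0 ≤ ‖w‖⁻¹ := by positivity
      exact mul_nonpos_of_nonneg_of_nonpos this (mul_nonpos_of_nonneg_of_nonpos this hws)
  obtain ⟨r, ⟨⟨r', w⟩, hrw, rfl⟩, hmin⟩ := (hZ.image continuous_fst).exists_isLeast
    ⟨t, hmem t ⟨ht, le_rfl⟩ v hv hvt⟩
  obtain ⟨⟨hr, hw⟩, hrw⟩ := hrw
  simp only [mem_preimage, mem_Iic] at hr hw hrw hmin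
  have hw0 : w ≠ 0 := by rintro rfl; simp at hw
  have hlt : ∀ s, 0 ≤ s → s < r' → ∀ z : m → ℝ, z ≠ 0 → 0 < z ⬝ᵥ D s *ᵥ z := by
    intro s hs0 hsr z hz
    by_contra! h
    exact absurd (hmin (hmem s ⟨hs0, hsr.le.trans hr.2⟩ z hz h)) (not_le.2 hsr)
  have hr0 : 0 < r' := by
    refine lt_of_le_of_ne hr.1 ?_
    rintro rfl
    exact absurd hrw (not_le.2 ((posDef_iff_real (hsymm 0 le_rfl)).1 h0 w hw0))
  have hder : ∀ z : m → ℝ, HasDerivWithinAt (fun s => z ⬝ᵥ D s *ᵥ z) (z ⬝ᵥ D' r' *ᵥ z)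
      (Ioo 0 r') r' := fun z => by
    have := (hD r' hr.1).quadForm (hasDerivWithinAt_const r' (Ici 0) z) (hsymm r' hr.1)
    simpa using this.mono (Ioo_subset_Icc_self.trans Icc_subset_Ici_self)
  have hne : (nhdsWithin r' (Ioo 0 r')).NeBot := right_nhdsWithin_Ioo_neBot hr0
  have hpsd : ∀ z : m → ℝ, 0 ≤ z ⬝ᵥ D r' *ᵥ z := fun z => by
    refine ge_of_tendsto (hder z).continuousWithinAt.tendsto ?_
    filter_upwards [self_mem_nhdsWithin] with s hs
    rcases eq_or_ne z 0 with rfl | hz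
    · simp
    · exact (hlt s hs.1.le hs.2 z hz).le
  have hzero : w ⬝ᵥ D r' *ᵥ w = 0 := le_antisymm hrw (hpsd w)
  have hPSD : (D r').PosSemidef := PosSemidef.of_dotProduct_mulVec_nonneg
    (by simpa [IsHermitian] using hsymm r' hr.1) fun z => by simpa using hpsd z
  have hker : D r' *ᵥ w = 0 := (hPSD.dotProduct_mulVec_zero_iff w).1 (by simpa using hzero)
  have hp := hpos r' hr.1 w hw0 hpsd hker
  refine absurd hp (not_lt.2 ?_)
  have hs := (hasDerivWithinAt_iff_tendsto_slope' (by simp)).1 (hder w)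
  refine le_of_tendsto hs ?_
  filter_upwards [self_mem_nhdsWithin] with s hs
  rw [slope_def_field, hzero]
  exact div_nonpos_of_nonneg_of_nonpos (by linarith [hlt s hs.1.le hs.2 w hw0])
    (by linarith [hs.2])

/-- The derivative of the inverse of a matrix function. -/
theorem HasDerivWithinAt.matrix_inv [DecidableEq m] {M : ℝ → Matrix m m ℝ} {M' : Matrix m m ℝ}
    {s : Set ℝ} {t : ℝ} (h : HasDerivWithinAt M M' s t) (hu : IsUnit (M t)) :
    HasDerivWithinAt (fun r => (M r)⁻¹) (-((M t)⁻¹ * M' * (M t)⁻¹)) s t := by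
  obtain ⟨x, hx⟩ := hu
  have h1 := hasFDerivAt_ringInverse (𝕜 := ℝ) x
  rw [hx] at h1
  have h2 := h1.comp_hasDerivWithinAt t h
  have e : (x⁻¹ : (Matrix m m ℝ)ˣ).val = (M t)⁻¹ := by rw [← hx, Matrix.coe_units_inv]
  simp only [nonsing_inv_eq_ringInverse]
  refine h2.congr_deriv ?_
  simp [e, nonsing_inv_eq_ringInverse]

end MatrixCalculus

/-! ### The Riccati equation: existence, symmetry and lower bounds. -/

section Riccati

open scoped Matrix.Norms.Operator

variable {m : Type*} [Fintype m]

theorem dotProduct_mul_mulVec_of_symm {M N : Matrix m m ℝ} (hM : Mᵀ = M) (v w : m → ℝ) :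
    v ⬝ᵥ (M * N) *ᵥ w = (M *ᵥ v) ⬝ᵥ N *ᵥ w := by
  rw [← mulVec_mulVec, dotProduct_mulVec, ← mulVec_transpose, hM]

theorem dotProduct_transpose_mul_mulVec {k : Type*} [Fintype k] (M N : Matrix k m ℝ)
    (v w : m → ℝ) :
    v ⬝ᵥ (Mᵀ * N) *ᵥ w = (N *ᵥ w) ⬝ᵥ M *ᵥ v := by
  rw [← mulVec_mulVec, dotProduct_transpose_mulVec]

theorem dotProduct_self_pos {v : m → ℝ} (hv : v ≠ 0) : 0 < v ⬝ᵥ v := by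
  simpa using dotProduct_star_self_pos_iff.2 hv

theorem dotProduct_self_nonneg' (v : m → ℝ) : 0 ≤ v ⬝ᵥ v :=
  Finset.sum_nonneg fun i _ => mul_self_nonneg (v i)

/-- A positive definite matrix dominates a positive multiple of the identity. -/
theorem Matrix.PosDef.exists_pos_mul_dotProduct_le {M : Matrix m m ℝ} (hM : M.PosDef) :
    ∃ c : ℝ, 0 < c ∧ ∀ v : m → ℝ, c * (v ⬝ᵥ v) ≤ v ⬝ᵥ M *ᵥ v := by
  have hs : Mᵀ = M := by simpa [IsHermitian] using hM.isHermitian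
  rw [posDef_iff_real hs] at hM
  -- The unit sphere below is that of the sup norm, on which `v ⬝ᵥ v ≤ card m`; the `+ 1` keeps `N`
  -- positive when `m` is empty.
  let N : ℝ := Fintype.card m + 1
  have hN : 0 < N := by positivity
  have hle : ∀ v : m → ℝ, ‖v‖ = 1 → v ⬝ᵥ v ≤ N := fun v hv => by
    have h1 : v ⬝ᵥ v ≤ ∑ _i : m, (1 : ℝ) := by
      refine Finset.sum_le_sum fun i _ => ?_
      have := norm_le_pi_norm v i
      rw [hv, Real.norm_eq_abs] at this
      rw [← abs_mul_abs_self]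
      nlinarith [abs_nonneg (v i)]
    simp only [Finset.sum_const, Finset.card_univ, nsmul_eq_mul, mul_one] at h1
    simp only [N]; linarith
  have hc : ContinuousOn (fun v : m → ℝ => v ⬝ᵥ M *ᵥ v) (Metric.sphere 0 1) :=
    (by fun_prop : Continuous fun v : m → ℝ => v ⬝ᵥ M *ᵥ v).continuousOn
  have main : ∃ c : ℝ, 0 < c ∧ ∀ v : m → ℝ, ‖v‖ = 1 → c ≤ v ⬝ᵥ M *ᵥ v := by
    rcases (Metric.sphere (0 : m → ℝ) 1).eq_empty_or_nonempty with h | h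
    · exact ⟨1, one_pos, fun v hv => absurd (show v ∈ Metric.sphere (0 : m → ℝ) 1 by simpa using hv)
        (by simp [h])⟩
    · obtain ⟨w, hw, hmin⟩ := (isCompact_sphere (0 : m → ℝ) 1).exists_isMinOn h hc
      refine ⟨_, hM w ?_, fun v hv => hmin (show v ∈ Metric.sphere (0 : m → ℝ) 1 by simpa using hv)⟩
      rintro rfl; simp at hw
  obtain ⟨c, hc0, hcl⟩ := main
  refine ⟨c / N, by positivity, fun v => ?_⟩
  rcases eq_or_ne v 0 with rfl | hv
  · simp
  have hn : 0 < ‖v‖ := norm_pos_iff.2 hv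
  have h1 : ‖‖v‖⁻¹ • v‖ = 1 := by simp [norm_smul, hv]
  have h2 := hcl _ h1
  have h3 := hle _ h1
  simp only [mulVec_smul, dotProduct_smul, smul_dotProduct, smul_eq_mul] at h2 h3
  have h4 : c / N * (‖v‖⁻¹ * (‖v‖⁻¹ * v ⬝ᵥ v)) ≤ ‖v‖⁻¹ * (‖v‖⁻¹ * v ⬝ᵥ M *ᵥ v) := by
    refine le_trans ?_ h2
    calc c / N * (‖v‖⁻¹ * (‖v‖⁻¹ * v ⬝ᵥ v)) ≤ c / N * N := by gcongr
      _ = c := by field_simp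
  have h5 : 0 < ‖v‖⁻¹ * ‖v‖⁻¹ := by positivity
  refine le_of_mul_le_mul_left ?_ h5
  linarith

/-- For `0 ≤ M ≤ r I`, also `M² ≤ r M`. -/
theorem mulVec_dotProduct_mulVec_le {M : Matrix m m ℝ} {r : ℝ} (hr : 0 < r) (hs : Mᵀ = M)
    (h0 : ∀ v : m → ℝ, 0 ≤ v ⬝ᵥ M *ᵥ v) (h1 : ∀ v : m → ℝ, v ⬝ᵥ M *ᵥ v ≤ r * (v ⬝ᵥ v))
    (v : m → ℝ) : (M *ᵥ v) ⬝ᵥ (M *ᵥ v) ≤ r * (v ⬝ᵥ M *ᵥ v) := by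
  -- Expanding gives `2 r |Mv|² ≤ r² vᵀMv + (Mv)ᵀM(Mv)`, and the last term is at most `r |Mv|²`.
  have h2 := h0 (r • v - M *ᵥ v)
  have h3 := h1 (M *ᵥ v)
  have e : v ⬝ᵥ M *ᵥ (M *ᵥ v) = (M *ᵥ v) ⬝ᵥ (M *ᵥ v) := by
    rw [mulVec_mulVec, dotProduct_mul_mulVec_of_symm hs]
  simp only [mulVec_sub, mulVec_smul, dotProduct_sub, sub_dotProduct, dotProduct_smul,
    smul_dotProduct, smul_eq_mul, e] at h2
  refine le_of_mul_le_mul_left ?_ hr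
  linarith

/-- The matrix Riccati equation has a solution on `[0, ∞)`, obtained from the linear Hamiltonian
system. -/
theorem exists_riccati_solution [DecidableEq m] {A S V : ℝ → Matrix m m ℝ}
    (hA : ContinuousOn A (Ici 0)) (hSc : ContinuousOn S (Ici 0)) (hVc : ContinuousOn V (Ici 0))
    (hS : ∀ t, 0 ≤ t → ∀ v : m → ℝ, 0 ≤ v ⬝ᵥ S t *ᵥ v)
    (hV : ∀ t, 0 ≤ t → ∀ v : m → ℝ, 0 ≤ v ⬝ᵥ V t *ᵥ v)
    {P₀ : Matrix m m ℝ} (hP₀ : P₀.PosDef) :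
    ∃ P : ℝ → Matrix m m ℝ, P 0 = P₀ ∧ ∀ t, 0 ≤ t →
      HasDerivWithinAt P (A t * P t + P t * (A t)ᵀ - P t * S t * P t + V t) (Ici 0) t := by
  let mulL : Matrix m m ℝ → Matrix m m ℝ →L[ℝ] Matrix m m ℝ := ContinuousLinearMap.mul ℝ _
  let fstL := ContinuousLinearMap.fst ℝ (Matrix m m ℝ) (Matrix m m ℝ)
  let sndL := ContinuousLinearMap.snd ℝ (Matrix m m ℝ) (Matrix m m ℝ)
  let L : ℝ → (Matrix m m ℝ × Matrix m m ℝ) →L[ℝ] (Matrix m m ℝ × Matrix m m ℝ) := fun t =>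
    ((mulL (-(A t)ᵀ)).comp fstL + (mulL (S t)).comp sndL).prod
      ((mulL (V t)).comp fstL + (mulL (A t)).comp sndL)
  have hLe : ∀ t p, L t p = (-(A t)ᵀ * p.1 + S t * p.2, V t * p.1 + A t * p.2) :=
    fun t p => rfl
  have hAT : ContinuousOn (fun t => (A t)ᵀ) (Ici 0) :=
    (continuous_id.matrix_transpose : Continuous fun M : Matrix m m ℝ => Mᵀ).comp_continuousOn hA
  have hL : ContinuousOn L (Ici 0) := by
    refine continuousOn_clm_apply.2 fun p => ?_
    exact ((hAT.neg.mul continuousOn_const).add (hSc.mul continuousOn_const)).prodMk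
      ((hVc.mul continuousOn_const).add (hA.mul continuousOn_const))
  obtain ⟨Z, hZ0, hZ⟩ := exists_forall_hasDerivWithinAt_linear hL
    (continuousOn_const (c := 0)) ((1 : Matrix m m ℝ), P₀)
  let X : ℝ → Matrix m m ℝ := fun t => (Z t).1
  let Y : ℝ → Matrix m m ℝ := fun t => (Z t).2
  have hX : ∀ t, 0 ≤ t → HasDerivWithinAt X (-(A t)ᵀ * X t + S t * Y t) (Ici 0) t :=
    fun t ht => (fstL.hasFDerivAt.comp_hasDerivWithinAt t (hZ t ht)).congr_deriv
      (by rw [add_zero]; rfl)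
  have hY : ∀ t, 0 ≤ t → HasDerivWithinAt Y (V t * X t + A t * Y t) (Ici 0) t :=
    fun t ht => (sndL.hasFDerivAt.comp_hasDerivWithinAt t (hZ t ht)).congr_deriv
      (by rw [add_zero]; rfl)
  have hP0' := (posDef_iff_real (by simpa [IsHermitian] using hP₀.isHermitian)).1 hP₀
  -- The derivative of `(Xv) · (Yv)` is `(Yv)ᵀS(Yv) + (Xv)ᵀV(Xv) ≥ 0`, so the pairing keeps its
  -- positive initial value `vᵀP₀v`. Hence `X` never becomes singular and `P = Y X⁻¹` is global.
  have hXY : ∀ v : m → ℝ, v ≠ 0 → ∀ t, 0 ≤ t → 0 < (X t *ᵥ v) ⬝ᵥ (Y t *ᵥ v) := fun v hv t ht => by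
    have hd : ∀ s, 0 ≤ s → HasDerivWithinAt (fun r => (X r *ᵥ v) ⬝ᵥ (Y r *ᵥ v))
        ((Y s *ᵥ v) ⬝ᵥ S s *ᵥ (Y s *ᵥ v) + (X s *ᵥ v) ⬝ᵥ V s *ᵥ (X s *ᵥ v)) (Ici 0) s :=
      fun s hs => by
        have hc := hasDerivWithinAt_const s (Ici 0) v
        refine (((hX s hs).mulVec hc).dotProduct ((hY s hs).mulVec hc)).congr_deriv ?_
        simp only [mulVec_zero, add_zero, add_mulVec, neg_mul, neg_mulVec, ← mulVec_mulVec,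
          dotProduct_add, add_dotProduct, neg_dotProduct]
        rw [dotProduct_comm ((A s)ᵀ *ᵥ _), dotProduct_transpose_mulVec, dotProduct_comm (S s *ᵥ _)]
        ring
    have hmono : MonotoneOn (fun r => (X r *ᵥ v) ⬝ᵥ (Y r *ᵥ v)) (Ici 0) := by
      refine monotoneOn_of_hasDerivWithinAt_nonneg (convex_Ici 0)
        (fun s hs => (hd s hs).continuousWithinAt)
        (fun s hs => (hd s (interior_subset hs)).mono interior_subset) fun s hs => ?_
      have hs := interior_subset hs
      exact add_nonneg (hS s hs _) (hV s hs _)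
    refine lt_of_lt_of_le ?_ (hmono self_mem_Ici ht ht)
    simpa [X, Y, hZ0] using hP0' v hv
  have hunit : ∀ t, 0 ≤ t → IsUnit (X t) := fun t ht => by
    rw [← mulVec_injective_iff_isUnit]
    refine (injective_iff_map_eq_zero (mulVecLin (X t))).2 fun v hv => ?_
    by_contra hne
    have := hXY v hne t ht
    rw [mulVecLin_apply] at hv
    rw [hv, zero_dotProduct] at this
    exact lt_irrefl _ this
  refine ⟨fun t => Y t * (X t)⁻¹, by simp [X, Y, hZ0], fun t ht => ?_⟩
  refine ((hY t ht).fun_mul ((hX t ht).matrix_inv (hunit t ht))).congr_deriv ?_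
  have h1 : X t * (X t)⁻¹ = 1 := mul_nonsing_inv _ ((isUnit_iff_isUnit_det _).1 (hunit t ht))
  beta_reduce
  generalize (X t)⁻¹ = J at *
  have h2 : J * (-(A t)ᵀ * X t + S t * Y t) * J = -(J * (A t)ᵀ) + J * S t * (Y t * J) := by
    calc _ = -(J * (A t)ᵀ * (X t * J)) + J * S t * (Y t * J) := by noncomm_ring
      _ = _ := by rw [h1, mul_one]
  have h3 : (V t * X t + A t * Y t) * J = V t + A t * (Y t * J) := by
    rw [add_mul, mul_assoc, h1, mul_one, mul_assoc]
  rw [h2, h3]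
  noncomm_ring

/-- Solutions of the Riccati equation with symmetric data are symmetric. -/
theorem riccati_symm {A S V P : ℝ → Matrix m m ℝ}
    (hA : ContinuousOn A (Ici 0)) (hSc : ContinuousOn S (Ici 0))
    (hS : ∀ t, 0 ≤ t → (S t)ᵀ = S t) (hV : ∀ t, 0 ≤ t → (V t)ᵀ = V t) (hP0 : (P 0)ᵀ = P 0)
    (hP : ∀ t, 0 ≤ t →
      HasDerivWithinAt P (A t * P t + P t * (A t)ᵀ - P t * S t * P t + V t) (Ici 0) t)
    (t : ℝ) (ht : 0 ≤ t) : (P t)ᵀ = P t := by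
  have hPc : ContinuousOn P (Ici 0) := fun s hs => (hP s hs).continuousWithinAt
  have hT : Continuous fun M : Matrix m m ℝ => Mᵀ := continuous_id.matrix_transpose
  have hAT : ContinuousOn (fun t => (A t)ᵀ) (Ici 0) := hT.comp_continuousOn hA
  have hPT : ContinuousOn (fun t => (P t)ᵀ) (Ici 0) := hT.comp_continuousOn hPc
  -- From `P S P - Pᵀ S Pᵀ = P S D + D S Pᵀ`, the antisymmetric defect `D` solves a linear
  -- homogeneous equation, so Grönwall applies.
  let F : ℝ → Matrix m m ℝ := fun s => A s - P s * S s
  let G : ℝ → Matrix m m ℝ := fun s => (A s)ᵀ - S s * (P s)ᵀ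
  let D : ℝ → Matrix m m ℝ := fun s => P s - (P s)ᵀ
  have hD : ∀ s, 0 ≤ s → HasDerivWithinAt D (F s * D s + D s * G s) (Ici 0) s := fun s hs => by
    refine ((hP s hs).fun_sub (hP s hs).matrix_transpose).congr_deriv ?_
    simp only [transpose_add, transpose_sub, transpose_mul, transpose_transpose, hS s hs, hV s hs]
    simp only [F, G, D]
    noncomm_ring
  have hFG : ContinuousOn (fun s => ‖F s‖ + ‖G s‖) (Icc 0 t) :=
    (((hA.sub (hPc.mul hSc)).norm).add ((hAT.sub (hSc.mul hPT)).norm)).mono Icc_subset_Ici_self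
  obtain ⟨K, hK⟩ := isCompact_Icc.bddAbove_image hFG
  have h := eq_zero_of_abs_deriv_le_mul_abs_self_of_eq_zero_right (f := D)
    (f' := fun s => F s * D s + D s * G s) (K := K) (a := 0) (b := t)
    (fun s hs => ((hD s hs.1).continuousWithinAt).mono Icc_subset_Ici_self)
    (fun s hs => (hD s hs.1).mono (Ici_subset_Ici.2 hs.1)) (by simp [D, hP0])
    (fun s hs => by
      have h1 : ‖F s‖ + ‖G s‖ ≤ K := hK ⟨s, Ico_subset_Icc_self hs, rfl⟩
      refine (norm_add_le _ _).trans ?_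
      have h2 := norm_mul_le (F s) (D s)
      have h3 := norm_mul_le (D s) (G s)
      nlinarith [norm_nonneg (D s)]) t ⟨ht, le_rfl⟩
  exact (sub_eq_zero.1 h).symm

/-- A uniform lower bound for the solution of the Riccati equation. -/
theorem riccati_lower_bound [DecidableEq m] {A S V P : ℝ → Matrix m m ℝ} {B b ε : ℝ} (hB : 0 ≤ B)
    (hb : 0 ≤ b) (hε : 0 < ε)
    (hA : ∀ t, 0 ≤ t → ∀ v : m → ℝ, |v ⬝ᵥ A t *ᵥ v| ≤ B * (v ⬝ᵥ v))
    (hS : ∀ t, 0 ≤ t → ∀ v : m → ℝ, v ⬝ᵥ S t *ᵥ v ≤ b * (v ⬝ᵥ v))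
    (hV : ∀ t, 0 ≤ t → ∀ v : m → ℝ, ε * (v ⬝ᵥ v) ≤ v ⬝ᵥ V t *ᵥ v)
    (hsymm : ∀ t, 0 ≤ t → (P t)ᵀ = P t) (hP0 : (P 0).PosDef)
    (hP : ∀ t, 0 ≤ t →
      HasDerivWithinAt P (A t * P t + P t * (A t)ᵀ - P t * S t * P t + V t) (Ici 0) t) :
    ∃ p : ℝ, 0 < p ∧ ∀ t, 0 ≤ t → ∀ v : m → ℝ, p * (v ⬝ᵥ v) ≤ v ⬝ᵥ P t *ᵥ v := by
  obtain ⟨c, hc, hcl⟩ := hP0.exists_pos_mul_dotProduct_le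
  obtain ⟨p, hp, hpc, hp1, hpε⟩ : ∃ p : ℝ, 0 < p ∧ p < c ∧ p ≤ 1 ∧ p * (2 * B + b) < ε := by
    refine ⟨min (c / 2) (min 1 (ε / (2 * B + b + 1))), by positivity, ?_, ?_, ?_⟩
    · exact (min_le_left _ _).trans_lt (by linarith)
    · exact (min_le_right _ _).trans (min_le_left _ _)
    · have h : min (c / 2) (min 1 (ε / (2 * B + b + 1))) ≤ ε / (2 * B + b + 1) :=
        (min_le_right _ _).trans (min_le_right _ _)
      rw [le_div_iff₀ (by positivity)] at h
      have h' : 0 < min (c / 2) (min 1 (ε / (2 * B + b + 1))) := by positivity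
      linarith
  have hone : ∀ v : m → ℝ, v ⬝ᵥ (p • (1 : Matrix m m ℝ)) *ᵥ v = p * (v ⬝ᵥ v) := fun v => by
    simp [smul_mulVec]
  have hDs : ∀ t, 0 ≤ t → (P t - p • (1 : Matrix m m ℝ))ᵀ = P t - p • (1 : Matrix m m ℝ) :=
    fun t ht => by simp [hsymm t ht]
  have hpd : ∀ t, 0 ≤ t → (P t - p • (1 : Matrix m m ℝ)).PosDef := by
    refine posDef_of_barrier hDs (fun t ht => (hP t ht).sub_const _) ?_ ?_
    · rw [posDef_iff_real (hDs 0 le_rfl)]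
      intro v hv
      rw [sub_mulVec, dotProduct_sub, hone]
      have := hcl v
      have := dotProduct_self_pos hv
      nlinarith
    -- At contact `P v = p v`, so the form of the derivative is at least `(ε - 2 p B - p² b) |v|²`;
    -- the choice of `p`, with `p² ≤ p`, makes this positive.
    · intro t ht v hv _ hker
      have hPv : P t *ᵥ v = p • v := by
        rw [sub_mulVec, sub_eq_zero] at hker
        simpa [smul_mulVec] using hker
      have hvv := dotProduct_self_pos hv
      have h1 := abs_le.1 (hA t ht v)
      have h2 := hS t ht v
      have h3 := hV t ht v
      have e1 : v ⬝ᵥ (A t * P t) *ᵥ v = p * (v ⬝ᵥ A t *ᵥ v) := by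
        rw [← mulVec_mulVec, hPv, mulVec_smul, dotProduct_smul, smul_eq_mul]
      have e2 : v ⬝ᵥ (P t * (A t)ᵀ) *ᵥ v = p * (v ⬝ᵥ A t *ᵥ v) := by
        rw [dotProduct_mul_mulVec_of_symm (hsymm t ht), hPv, smul_dotProduct,
          dotProduct_transpose_mulVec, smul_eq_mul]
      have e3 : v ⬝ᵥ (P t * S t * P t) *ᵥ v = p * p * (v ⬝ᵥ S t *ᵥ v) := by
        rw [mul_assoc, dotProduct_mul_mulVec_of_symm (hsymm t ht), ← mulVec_mulVec, hPv,
          mulVec_smul, dotProduct_smul, smul_dotProduct, smul_eq_mul, smul_eq_mul, mul_assoc]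
      rw [add_mulVec, sub_mulVec, add_mulVec, dotProduct_add, dotProduct_sub, dotProduct_add,
        e1, e2, e3]
      have h4 : p * p * (v ⬝ᵥ S t *ᵥ v) ≤ p * p * (b * (v ⬝ᵥ v)) := by gcongr
      have h5 : p * p * (b * (v ⬝ᵥ v)) ≤ p * 1 * (b * (v ⬝ᵥ v)) := by
        have : 0 ≤ b * (v ⬝ᵥ v) := by positivity
        gcongr
      have h6 : p * (-(B * (v ⬝ᵥ v))) ≤ p * (v ⬝ᵥ A t *ᵥ v) := by gcongr; exact h1.1
      nlinarith
  refine ⟨p, hp, fun t ht v => ?_⟩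
  have := (hpd t ht).posSemidef.dotProduct_mulVec_nonneg v
  rw [sub_mulVec, dotProduct_sub, star_trivial, hone] at this
  linarith

/-- A uniform lower bound for the inverse of the solution of the Riccati equation, from a bounded
and uniformly positive definite solution `R` of a Lyapunov equation. -/
theorem information_lower_bound {A S V Q R : ℝ → Matrix m m ℝ} {W : Matrix m m ℝ}
    {b ε ρ r : ℝ} (hb : 0 ≤ b) (hε : 0 < ε) (hρ : 0 < ρ) (hr : 0 < r)
    (hS : ∀ t, 0 ≤ t → ∀ v : m → ℝ, ε * (v ⬝ᵥ W *ᵥ v) ≤ v ⬝ᵥ S t *ᵥ v)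
    (hW : ∀ v : m → ℝ, 0 ≤ v ⬝ᵥ W *ᵥ v)
    (hV : ∀ t, 0 ≤ t → ∀ v : m → ℝ, v ⬝ᵥ V t *ᵥ v ≤ b * (v ⬝ᵥ v))
    (hsymm : ∀ t, 0 ≤ t → (Q t)ᵀ = Q t) (hQ0 : (Q 0).PosDef)
    (hQ : ∀ t, 0 ≤ t →
      HasDerivWithinAt Q (S t - Q t * A t - (A t)ᵀ * Q t - Q t * V t * Q t) (Ici 0) t)
    (hRs : ∀ t, 0 ≤ t → (R t)ᵀ = R t)
    (hR : ∀ t, 0 ≤ t →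
      HasDerivWithinAt R (W - R t - R t * A t - (A t)ᵀ * R t) (Ici 0) t)
    (hRl : ∀ t, 0 ≤ t → ∀ v : m → ℝ, ρ * (v ⬝ᵥ v) ≤ v ⬝ᵥ R t *ᵥ v)
    (hRu : ∀ t, 0 ≤ t → ∀ v : m → ℝ, v ⬝ᵥ R t *ᵥ v ≤ r * (v ⬝ᵥ v)) :
    ∃ α : ℝ, 0 < α ∧ ∀ t, 0 ≤ t → ∀ v : m → ℝ, α * (v ⬝ᵥ v) ≤ v ⬝ᵥ Q t *ᵥ v := by
  obtain ⟨c, hc, hcl⟩ := hQ0.exists_pos_mul_dotProduct_le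
  obtain ⟨η, hη, hηc, hηε, hηb⟩ : ∃ η : ℝ, 0 < η ∧ η * r < c ∧ η ≤ ε ∧ η * (b * r) < 1 := by
    refine ⟨min (c / (2 * r)) (min ε (1 / (b * r + 1))), by positivity, ?_, ?_, ?_⟩
    · calc min (c / (2 * r)) (min ε (1 / (b * r + 1))) * r ≤ c / (2 * r) * r := by
            gcongr; exact min_le_left _ _
        _ = c / 2 := by field_simp
        _ < c := by linarith
    · exact (min_le_right _ _).trans (min_le_left _ _)
    · have h : min (c / (2 * r)) (min ε (1 / (b * r + 1))) ≤ 1 / (b * r + 1) :=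
        (min_le_right _ _).trans (min_le_right _ _)
      rw [le_div_iff₀ (by positivity)] at h
      have h' : 0 < min (c / (2 * r)) (min ε (1 / (b * r + 1))) := by positivity
      linarith
  have hDs : ∀ t, 0 ≤ t → (Q t - η • R t)ᵀ = Q t - η • R t :=
    fun t ht => by simp [hsymm t ht, hRs t ht]
  have hq : ∀ t (v : m → ℝ), v ⬝ᵥ (Q t - η • R t) *ᵥ v =
      v ⬝ᵥ Q t *ᵥ v - η * (v ⬝ᵥ R t *ᵥ v) := fun t v => by
    rw [sub_mulVec, dotProduct_sub, smul_mulVec, dotProduct_smul, smul_eq_mul]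
  have hpd : ∀ t, 0 ≤ t → (Q t - η • R t).PosDef := by
    refine posDef_of_barrier hDs (fun t ht => (hQ t ht).sub ((hR t ht).const_smul η)) ?_ ?_
    · rw [posDef_iff_real (hDs 0 le_rfl)]
      intro v hv
      rw [hq]
      have h1 := hcl v
      have h2 := mul_le_mul_of_nonneg_left (hRu 0 le_rfl v) hη.le
      have h3 := dotProduct_self_pos hv
      nlinarith
    -- At contact `Q v = η R v`, so the terms in `A` cancel. The excess of `S` over `η W` is
    -- nonnegative since `η ≤ ε`, and `(Qv)ᵀV(Qv) ≤ η² b r vᵀRv < η vᵀRv` is beaten by the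
    -- forgetting term.
    · intro t ht v hv _ hker
      have hQv : Q t *ᵥ v = η • (R t *ᵥ v) := by
        rw [sub_mulVec, sub_eq_zero] at hker
        simpa [smul_mulVec] using hker
      have hvv := dotProduct_self_pos hv
      have h1 := hRl t ht v
      have hRv : 0 < v ⬝ᵥ R t *ᵥ v := lt_of_lt_of_le (by positivity) h1
      have h2 := mulVec_dotProduct_mulVec_le hr (hRs t ht)
        (fun z => le_trans (mul_nonneg hρ.le (dotProduct_self_nonneg' z)) (hRl t ht z))
        (hRu t ht) v
      have h3 := hV t ht (R t *ᵥ v)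
      have h4 := hS t ht v
      have h5 := hW v
      have e1 : v ⬝ᵥ (Q t * A t) *ᵥ v = η * (v ⬝ᵥ (R t * A t) *ᵥ v) := by
        rw [dotProduct_mul_mulVec_of_symm (hsymm t ht), dotProduct_mul_mulVec_of_symm (hRs t ht),
          hQv, smul_dotProduct, smul_eq_mul]
      have e2 : v ⬝ᵥ ((A t)ᵀ * Q t) *ᵥ v = η * (v ⬝ᵥ ((A t)ᵀ * R t) *ᵥ v) := by
        rw [dotProduct_transpose_mul_mulVec, dotProduct_transpose_mul_mulVec,
          hQv, smul_dotProduct, smul_eq_mul]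
      have e3 : v ⬝ᵥ (Q t * V t * Q t) *ᵥ v =
          η * η * ((R t *ᵥ v) ⬝ᵥ V t *ᵥ (R t *ᵥ v)) := by
        rw [mul_assoc, dotProduct_mul_mulVec_of_symm (hsymm t ht), ← mulVec_mulVec, hQv,
          mulVec_smul, dotProduct_smul, smul_dotProduct, smul_eq_mul, smul_eq_mul, mul_assoc]
      simp only [sub_mulVec, smul_mulVec, dotProduct_sub, dotProduct_smul, smul_eq_mul, e1, e2, e3]
      have h6 : η * η * ((R t *ᵥ v) ⬝ᵥ V t *ᵥ (R t *ᵥ v)) ≤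
          η * η * (b * (r * (v ⬝ᵥ R t *ᵥ v))) := by
        refine mul_le_mul_of_nonneg_left (h3.trans ?_) (by positivity)
        gcongr
      have h7 : η * η * (b * (r * (v ⬝ᵥ R t *ᵥ v))) < η * (v ⬝ᵥ R t *ᵥ v) := by
        have := mul_lt_mul_of_pos_right hηb (mul_pos hη hRv)
        linarith
      have h8 : η * (v ⬝ᵥ W *ᵥ v) ≤ ε * (v ⬝ᵥ W *ᵥ v) := by gcongr
      linarith
  refine ⟨η * ρ, by positivity, fun t ht v => ?_⟩
  have h1 := (hpd t ht).posSemidef.dotProduct_mulVec_nonneg v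
  rw [star_trivial, hq] at h1
  have h2 := mul_le_mul_of_nonneg_left (hRl t ht v) hη.le
  linarith

end Riccati

/-! ### Scalar observability estimates. -/

section ScalarEstimates

theorem mul_sub_le_sub_of_le_hasDerivWithinAt {f f' : ℝ → ℝ}
    (hf : ∀ s, 0 ≤ s → HasDerivWithinAt f (f' s) (Ici 0) s) {a b c : ℝ} (ha : 0 ≤ a) (hab : a ≤ b)
    (h : ∀ s ∈ Icc a b, c ≤ f' s) : c * (b - a) ≤ f b - f a := by
  have hsub : Icc a b ⊆ Ici 0 := fun s hs => ha.trans hs.1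
  have hd : ∀ s ∈ Icc a b, HasDerivWithinAt (fun r => f r - c * r) (f' s - c) (Icc a b) s :=
    fun s hs => by
      have := ((hf s (hsub hs)).mono hsub).fun_sub ((hasDerivWithinAt_id s (Icc a b)).const_mul c)
      simpa using this
  have hm : MonotoneOn (fun r => f r - c * r) (Icc a b) :=
    monotoneOn_of_hasDerivWithinAt_nonneg (convex_Icc a b)
      (fun s hs => (hd s hs).continuousWithinAt)
      (fun s hs => (hd s (interior_subset hs)).mono interior_subset)
      (fun s hs => sub_nonneg.2 (h s (interior_subset hs)))
  have := hm (left_mem_Icc.2 hab) (right_mem_Icc.2 hab) hab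
  simp only at this
  linarith

theorem abs_sub_le_of_abs_hasDerivWithinAt_le {f f' : ℝ → ℝ}
    (hf : ∀ s, 0 ≤ s → HasDerivWithinAt f (f' s) (Ici 0) s) {a b c : ℝ} (ha : 0 ≤ a) (hab : a ≤ b)
    (h : ∀ s, 0 ≤ s → |f' s| ≤ c) : |f b - f a| ≤ c * (b - a) := by
  have h1 := mul_sub_le_sub_of_le_hasDerivWithinAt hf ha hab (c := -c)
    fun s hs => (abs_le.1 (h s (ha.trans hs.1))).1
  have h2 := mul_sub_le_sub_of_le_hasDerivWithinAt (fun s hs => (hf s hs).fun_neg) ha hab (c := -c)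
    fun s hs => neg_le_neg (abs_le.1 (h s (ha.trans hs.1))).2
  exact abs_le.2 ⟨by linarith, by linarith⟩

variable {φ η : ℝ → ℝ}

theorem energy_growth
    (hφ : ∀ s, 0 ≤ s → HasDerivWithinAt φ (Real.exp s * η s ^ 2) (Ici 0) s) {a b c : ℝ}
    (ha : 0 ≤ a) (hab : a ≤ b) (hc : 0 ≤ c) (h : ∀ s ∈ Icc a b, c ≤ η s ^ 2) :
    Real.exp a * c * (b - a) ≤ φ b - φ a :=
  mul_sub_le_sub_of_le_hasDerivWithinAt hφ ha hab fun s hs =>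
    mul_le_mul (Real.exp_le_exp.2 hs.1) (h s hs) hc (Real.exp_pos s).le

theorem energy_mono
    (hφ : ∀ s, 0 ≤ s → HasDerivWithinAt φ (Real.exp s * η s ^ 2) (Ici 0) s) {a b : ℝ}
    (ha : 0 ≤ a) (hab : a ≤ b) : φ a ≤ φ b := by
  have := energy_growth hφ ha hab le_rfl fun s _ => sq_nonneg (η s)
  linarith

/-- A function with slope at least `m` on an interval of length `τ` is large in mean square. -/
theorem energy_growth_of_slope
    (hφ : ∀ s, 0 ≤ s → HasDerivWithinAt φ (Real.exp s * η s ^ 2) (Ici 0) s) {a τ m : ℝ}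
    (ha : 0 ≤ a) (hτ : 0 < τ) (hm : 0 ≤ m)
    (h : ∀ s₁ s₂, a ≤ s₁ → s₁ ≤ s₂ → s₂ ≤ a + τ → m * (s₂ - s₁) ≤ η s₂ - η s₁) :
    Real.exp a * (m * (τ / 4)) ^ 2 * (τ / 4) ≤ φ (a + τ) - φ a := by
  have hm4 : 0 ≤ m * (τ / 4) := by positivity
  -- According to the sign at the midpoint, `|η| ≥ m τ / 4` holds on the last or on the first
  -- quarter.
  rcases le_total 0 (η (a + τ / 2)) with h0 | h0
  · have h1 := energy_mono hφ ha (show a ≤ a + 3 * (τ / 4) by linarith)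
    have h2 := energy_growth hφ (a := a + 3 * (τ / 4)) (b := a + τ) (by positivity) (by linarith)
      (sq_nonneg (m * (τ / 4))) fun s hs => by
        have h3 := h (a + τ / 2) s (by linarith) (by linarith [hs.1]) hs.2
        have h4 : m * (τ / 4) ≤ m * (s - (a + τ / 2)) :=
          mul_le_mul_of_nonneg_left (by linarith [hs.1]) hm
        exact pow_le_pow_left₀ hm4 (by linarith) 2
    have h5 : Real.exp a * (m * (τ / 4)) ^ 2 * (τ / 4) ≤
        Real.exp (a + 3 * (τ / 4)) * (m * (τ / 4)) ^ 2 * (τ / 4) := by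
      gcongr; linarith
    rw [show a + τ - (a + 3 * (τ / 4)) = τ / 4 by ring] at h2
    linarith
  · have h1 := energy_mono hφ (show 0 ≤ a + τ / 4 by positivity)
      (show a + τ / 4 ≤ a + τ by linarith)
    have h2 := energy_growth hφ (a := a) (b := a + τ / 4) ha (by linarith)
      (sq_nonneg (m * (τ / 4))) fun s hs => by
        have h3 := h s (a + τ / 2) hs.1 (by linarith [hs.2]) (by linarith)
        have h4 : m * (τ / 4) ≤ m * (a + τ / 2 - s) :=
          mul_le_mul_of_nonneg_left (by linarith [hs.2]) hm
        rw [← neg_sq (η s)]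
        exact pow_le_pow_left₀ hm4 (by linarith) 2
    rw [show a + τ / 4 - a = τ / 4 by ring] at h2
    linarith

/-- One time with `|g| ≥ 2m` suffices: oscillation at most `m` over length `τ` keeps `g` of one sign
and at least `m` in size on an interval of that length, where `η` is then steep. -/
theorem energy_growth_of_excited {g : ℝ → ℝ}
    (hφ : ∀ s, 0 ≤ s → HasDerivWithinAt φ (Real.exp s * η s ^ 2) (Ici 0) s)
    (hη : ∀ s, 0 ≤ s → HasDerivWithinAt η (g s) (Ici 0) s) {t δ τ m : ℝ}
    (hδt : δ ≤ t) (hτ : 0 < τ) (hτδ : τ ≤ δ) (hm : 0 ≤ m)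
    (hosc : ∀ s s', 0 ≤ s → 0 ≤ s' → |s - s'| ≤ τ → |g s - g s'| ≤ m)
    (hexc : ∃ s ∈ Icc (t - δ) t, 2 * m ≤ |g s|) :
    Real.exp (t - δ) * (m * (τ / 4)) ^ 2 * (τ / 4) ≤ φ t - φ 0 := by
  obtain ⟨s₀, ⟨h1, h2⟩, hs₀⟩ := hexc
  -- The interval of length `τ` starts at `s₀`, or ends at `t` when that would overrun the window.
  obtain ⟨a, hat, has, hsa, hta⟩ : ∃ a, t - δ ≤ a ∧ a ≤ s₀ ∧ s₀ ≤ a + τ ∧ a + τ ≤ t := by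
    rcases le_total s₀ (t - τ) with h | h
    · exact ⟨s₀, h1, le_rfl, by linarith, by linarith⟩
    · exact ⟨t - τ, by linarith, h, by linarith, by linarith⟩
  have ha : 0 ≤ a := by linarith
  have hnear : ∀ s ∈ Icc a (a + τ), |g s - g s₀| ≤ m := fun s hs =>
    hosc s s₀ (ha.trans hs.1) (by linarith)
      (abs_le.2 ⟨by linarith [hs.1], by linarith [hs.2]⟩)
  have key : Real.exp a * (m * (τ / 4)) ^ 2 * (τ / 4) ≤ φ (a + τ) - φ a := by
    rcases le_total 0 (g s₀) with hpos | hneg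
    · rw [abs_of_nonneg hpos] at hs₀
      refine energy_growth_of_slope hφ ha hτ hm fun s₁ s₂ h₁ h₁₂ h₂ => ?_
      refine mul_sub_le_sub_of_le_hasDerivWithinAt hη (ha.trans h₁) h₁₂ fun s hs => ?_
      have := (abs_le.1 (hnear s ⟨h₁.trans hs.1, hs.2.trans h₂⟩)).1
      linarith
    · rw [abs_of_nonpos hneg] at hs₀
      refine energy_growth_of_slope (η := fun s => -η s) (fun s hs => by simpa using hφ s hs)
        ha hτ hm fun s₁ s₂ h₁ h₁₂ h₂ => ?_
      refine mul_sub_le_sub_of_le_hasDerivWithinAt (fun s hs => (hη s hs).fun_neg)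
        (ha.trans h₁) h₁₂ fun s hs => ?_
      have := (abs_le.1 (hnear s ⟨h₁.trans hs.1, hs.2.trans h₂⟩)).2
      linarith
  have h3 := energy_mono hφ le_rfl ha
  have h4 := energy_mono hφ (show 0 ≤ a + τ by linarith) hta
  have h5 : Real.exp (t - δ) * (m * (τ / 4)) ^ 2 * (τ / 4) ≤
      Real.exp a * (m * (τ / 4)) ^ 2 * (τ / 4) := by gcongr
  linarith

/-- Observability estimate: the final energy controls the slope bound and the final value. -/
theorem energy_lower_bound {B δ τ κ : ℝ} (hB : 0 ≤ B) (hδ : 0 < δ) (hτ : 0 < τ) (hτδ : τ ≤ δ)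
    (hκ : 0 < κ) : ∃ K : ℝ, 0 < K ∧ ∀ (φ η g : ℝ → ℝ) (X t : ℝ), 0 ≤ X → 0 ≤ t →
      (∀ s, 0 ≤ s → HasDerivWithinAt φ (Real.exp s * η s ^ 2) (Ici 0) s) →
      (∀ s, 0 ≤ s → HasDerivWithinAt η (g s) (Ici 0) s) →
      (∀ s, 0 ≤ s → |g s| ≤ B * X) →
      (∀ s s', 0 ≤ s → 0 ≤ s' → |s - s'| ≤ τ → |g s - g s'| ≤ κ * X) →
      (∀ t, 0 ≤ t → ∃ s ∈ Icc t (t + δ), 2 * (κ * X) ≤ |g s|) →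
      X ^ 2 + η 0 ^ 2 ≤ φ 0 →
      Real.exp t * (X ^ 2 + η t ^ 2) ≤ K * φ t := by
  -- `c₁` is the energy gained from one excitation when `X = 1`. `K₁` serves times `t ≤ δ`, where
  -- the initial energy suffices, and `K₂` serves `t ≥ δ`, where a full window `[t - δ, t]` is
  -- available.
  let c₁ := (κ * (τ / 4)) ^ 2 * (τ / 4)
  have hc₁ : 0 < c₁ := by positivity
  let K₁ := Real.exp δ * (2 + 2 * (B * δ) ^ 2)
  let K₂ := Real.exp δ * (1 / c₁ + 2 / δ + 2 * (B * δ) ^ 2 / c₁)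
  have hK₁ : 0 < K₁ := by positivity
  have hK₂ : 0 < K₂ := by positivity
  refine ⟨K₁ + K₂, by positivity, fun φ η g X t hX ht hφ hη hg hosc hexc h0 => ?_⟩
  have hφ0 : 0 ≤ φ 0 := le_trans (by positivity) h0
  have hφt : φ 0 ≤ φ t := energy_mono hφ le_rfl ht
  have hsq : ∀ s, 0 ≤ s → s ≤ t → t ≤ s + δ →
      η t ^ 2 ≤ 2 * η s ^ 2 + 2 * (B * δ) ^ 2 * X ^ 2 := fun s hs hst hts => by
    have h1 := abs_sub_le_of_abs_hasDerivWithinAt_le hη hs hst hg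
    have h2 : |η t - η s| ≤ B * δ * X := h1.trans (by
      have : B * X * (t - s) ≤ B * X * δ := by gcongr; linarith
      linarith)
    have h3 : (η t - η s) ^ 2 ≤ (B * δ * X) ^ 2 := sq_le_sq' (abs_le.1 h2).1 (abs_le.1 h2).2
    nlinarith [sq_nonneg (η t - 2 * η s)]
  rcases le_total t δ with htδ | htδ
  · have h1 := hsq 0 le_rfl ht (by linarith)
    have h2 : Real.exp t ≤ Real.exp δ := Real.exp_le_exp.2 htδ
    have h3 : X ^ 2 + η t ^ 2 ≤ (2 + 2 * (B * δ) ^ 2) * φ t := by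
      have h4 : X ^ 2 ≤ φ t := by nlinarith [sq_nonneg (η 0)]
      have h5 : X ^ 2 + η 0 ^ 2 ≤ φ t := h0.trans hφt
      have h6 : 2 * (B * δ) ^ 2 * X ^ 2 ≤ 2 * (B * δ) ^ 2 * φ t := by gcongr
      nlinarith [sq_nonneg X]
    have h7 : Real.exp t * (X ^ 2 + η t ^ 2) ≤ Real.exp δ * ((2 + 2 * (B * δ) ^ 2) * φ t) := by
      gcongr
    have h8 : 0 ≤ K₂ * φ t := mul_nonneg hK₂.le (hφ0.trans hφt)
    simp only [K₁] at *
    linarith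
  · have hE : Real.exp t = Real.exp δ * Real.exp (t - δ) := by rw [← Real.exp_add]; congr 1; ring
    let e := Real.exp (t - δ)
    have he : 0 < e := Real.exp_pos _
    have h1 : e * c₁ * X ^ 2 ≤ φ t := by
      have := energy_growth_of_excited hφ hη htδ hτ hτδ (m := κ * X) (by positivity) hosc
        (by simpa using hexc (t - δ) (by linarith))
      simp only [e, c₁]
      nlinarith
    -- Over the window `η` moves by at most `B δ X`, so a large final value forces `η` to be large
    -- throughout; the deficit in `X²` is paid by `h1`.
    have h2 : e * (η t ^ 2 / 2 - (B * δ) ^ 2 * X ^ 2) * δ ≤ φ t := by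
      have hpos : 0 ≤ φ (t - δ) := hφ0.trans (energy_mono hφ le_rfl (by linarith))
      rcases le_total 0 (η t ^ 2 / 2 - (B * δ) ^ 2 * X ^ 2) with hc | hc
      · have := energy_growth hφ (a := t - δ) (b := t) (by linarith) (by linarith) hc
          fun s hs => by
            have := hsq s (by linarith [hs.1]) hs.2 (by linarith [hs.1])
            linarith
        simp only [sub_sub_cancel] at this
        linarith
      · have : e * (η t ^ 2 / 2 - (B * δ) ^ 2 * X ^ 2) * δ ≤ 0 :=
          mul_nonpos_of_nonpos_of_nonneg (mul_nonpos_of_nonneg_of_nonpos he.le hc) hδ.le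
        linarith
    have h3 : e * X ^ 2 ≤ φ t / c₁ := by rw [le_div_iff₀ hc₁]; linarith
    have h4 : e * (η t ^ 2 / 2 - (B * δ) ^ 2 * X ^ 2) ≤ φ t / δ := by rwa [le_div_iff₀ hδ]
    have h5 : (B * δ) ^ 2 * (e * X ^ 2) ≤ (B * δ) ^ 2 * (φ t / c₁) := by gcongr
    have h6 : e * (X ^ 2 + η t ^ 2) ≤ (1 / c₁ + 2 / δ + 2 * (B * δ) ^ 2 / c₁) * φ t := by
      have : (1 / c₁ + 2 / δ + 2 * (B * δ) ^ 2 / c₁) * φ t =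
        φ t / c₁ + 2 * (φ t / δ) + 2 * ((B * δ) ^ 2 * (φ t / c₁)) := by ring
      rw [this]; linarith
    have h7 := mul_le_mul_of_nonneg_left h6 (Real.exp_pos δ).le
    have h8 : 0 ≤ K₁ * φ t := mul_nonneg hK₁.le (hφ0.trans hφt)
    rw [hE]
    simp only [K₂, e] at *
    linarith

end ScalarEstimates

/-! ### The comparison Lyapunov equation. -/

section Lyapunov

open scoped Matrix.Norms.Operator

theorem exists_lyapunov_solution {m : Type*} [Fintype m] [DecidableEq m] {A : ℝ → Matrix m m ℝ}
    {W : Matrix m m ℝ} (hA : ContinuousOn A (Ici 0)) (hW : Wᵀ = W) :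
    ∃ R : ℝ → Matrix m m ℝ, R 0 = 1 ∧ (∀ t, (R t)ᵀ = R t) ∧ ∀ t, 0 ≤ t →
      HasDerivWithinAt R (W - R t - R t * A t - (A t)ᵀ * R t) (Ici 0) t := by
  let mulL : Matrix m m ℝ →L[ℝ] Matrix m m ℝ →L[ℝ] Matrix m m ℝ := ContinuousLinearMap.mul ℝ _
  let L : ℝ → Matrix m m ℝ →L[ℝ] Matrix m m ℝ := fun t =>
    -ContinuousLinearMap.id ℝ _ - mulL.flip (A t) - mulL (A t)ᵀ
  have hL : ContinuousOn L (Ici 0) := by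
    have hAT : ContinuousOn (fun t => (A t)ᵀ) (Ici 0) :=
      (continuous_id.matrix_transpose : Continuous fun M : Matrix m m ℝ => Mᵀ).comp_continuousOn hA
    exact (continuousOn_const.sub (mulL.flip.continuous.comp_continuousOn hA)).sub
      (mulL.continuous.comp_continuousOn hAT)
  obtain ⟨R, hR0, hR⟩ := exists_forall_hasDerivWithinAt_linear hL
    (continuousOn_const (c := W)) (1 : Matrix m m ℝ)
  -- The equation is linear and invariant under transposition, so averaging yields a symmetric
  -- solution without a uniqueness argument.
  refine ⟨fun t => (1 / 2 : ℝ) • (R t + (R t)ᵀ), ?_, fun t => ?_, fun t ht => ?_⟩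
  · beta_reduce
    rw [hR0, transpose_one, ← two_smul ℝ, smul_smul]; simp
  · simp [add_comm]
  · have h : HasDerivWithinAt R (-R t - R t * A t - (A t)ᵀ * R t + W) (Ici 0) t := hR t ht
    refine ((h.fun_add h.matrix_transpose).const_smul (1 / 2 : ℝ)).congr_deriv ?_
    simp only [transpose_add, transpose_sub, transpose_neg, transpose_mul, transpose_transpose, hW]
    simp only [smul_mul_assoc, mul_smul_comm]
    have : W = (1 / 2 : ℝ) • (W + W) := by rw [← two_smul ℝ, smul_smul]; simp
    rw [this]
    simp only [← smul_sub]
    rw [← this]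
    congr 1
    noncomm_ring

end Lyapunov

/-! ### Block structure of the augmented system, and excitation. -/

section AugmentedState

variable {n : ℕ}

/-- The position part of an augmented vector. -/
def augPos (v : AugIdx n → ℝ) : EuclideanSpace ℝ (Fin n) := WithLp.toLp 2 fun i => v (Sum.inl i)

/-- The output part of an augmented vector. -/
def augOut (v : AugIdx n → ℝ) : ℝ := v (Sum.inr ())

theorem aug_dotProduct_self (v : AugIdx n → ℝ) : v ⬝ᵥ v = ‖augPos v‖ ^ 2 + augOut v ^ 2 := by
  rw [EuclideanSpace.norm_sq_eq]
  simp [dotProduct, augPos, augOut, Fintype.sum_sum_type, ← pow_two]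

theorem stateMatrix_mulVec (a : EuclideanSpace ℝ (Fin n)) (v : AugIdx n → ℝ) :
    stateMatrix a *ᵥ v = Sum.elim (fun _ => 0) fun _ => inner ℝ a (augPos v) := by
  ext i
  rcases i with i | i <;>
    simp [stateMatrix, Matrix.mulVec, dotProduct, Fintype.sum_sum_type, PiLp.inner_apply, augPos,
      mul_comm]

theorem dotProduct_stateMatrix_mulVec (a : EuclideanSpace ℝ (Fin n)) (v w : AugIdx n → ℝ) :
    w ⬝ᵥ stateMatrix a *ᵥ v = augOut w * inner ℝ a (augPos v) := by
  rw [stateMatrix_mulVec]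
  simp [dotProduct, Fintype.sum_sum_type, augOut]

theorem abs_dotProduct_stateMatrix_le {a : EuclideanSpace ℝ (Fin n)} {B : ℝ} (ha : ‖a‖ ≤ B)
    (v : AugIdx n → ℝ) : |v ⬝ᵥ stateMatrix a *ᵥ v| ≤ B * (v ⬝ᵥ v) := by
  rw [dotProduct_stateMatrix_mulVec, aug_dotProduct_self, abs_mul]
  have hB : 0 ≤ B := (norm_nonneg a).trans ha
  have h1 : |inner ℝ a (augPos v)| ≤ B * ‖augPos v‖ :=
    (abs_real_inner_le_norm _ _).trans (by gcongr)
  have h2 : |augOut v| * |inner ℝ a (augPos v)| ≤ |augOut v| * (B * ‖augPos v‖) := by gcongr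
  have h3 : |augOut v| * ‖augPos v‖ ≤ ‖augPos v‖ ^ 2 + augOut v ^ 2 := by
    rw [← sq_abs (augOut v)]
    nlinarith [sq_nonneg (|augOut v| - ‖augPos v‖), sq_nonneg (|augOut v| + ‖augPos v‖)]
  nlinarith [mul_le_mul_of_nonneg_left h3 hB]

/-- The matrix `Cᵀ q C`. -/
def outputGram (n : ℕ) (q : ℝ) : Matrix (AugIdx n) (AugIdx n) ℝ :=
  (outputMatrix n)ᵀ * (q • outputMatrix n)

theorem outputMatrix_mulVec (v : AugIdx n → ℝ) : outputMatrix n *ᵥ v = fun _ => augOut v := by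
  ext i
  simp [outputMatrix, Matrix.mulVec, dotProduct, Fintype.sum_sum_type, augOut]

theorem dotProduct_outputGram_mulVec (q : ℝ) (v : AugIdx n → ℝ) :
    v ⬝ᵥ outputGram n q *ᵥ v = q * augOut v ^ 2 := by
  rw [outputGram, dotProduct_transpose_mul_mulVec, smul_mulVec, outputMatrix_mulVec]
  simp [dotProduct]
  ring

theorem outputGram_transpose (q : ℝ) : (outputGram n q)ᵀ = outputGram n q := by
  simp [outputGram, transpose_mul]

theorem continuousOn_stateMatrix {u : ℝ → EuclideanSpace ℝ (Fin n)} {s : Set ℝ}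
    (hu : ContinuousOn u s) : ContinuousOn (fun t => stateMatrix (u t)) s := by
  refine continuousOn_pi.2 fun i => continuousOn_pi.2 fun j => ?_
  rcases i with i | i <;> rcases j with j | j <;> simp only [stateMatrix, fromBlocks_apply₁₁,
    fromBlocks_apply₁₂, fromBlocks_apply₂₁, fromBlocks_apply₂₂, Matrix.zero_apply, of_apply]
  · exact continuousOn_const
  · exact continuousOn_const
  · exact (EuclideanSpace.proj (𝕜 := ℝ) j).continuous.comp_continuousOn hu
  · exact continuousOn_const

theorem continuousOn_outputGram {q : ℝ → ℝ} {s : Set ℝ} (hq : ContinuousOn q s) :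
    ContinuousOn (fun t => outputGram n (q t)) s := by
  have : (fun t => outputGram n (q t)) = fun t => q t • outputGram n 1 := by
    ext t; simp [outputGram]
  rw [this]
  exact hq.smul continuousOn_const

/-- Persistent excitation gives, in every window and every direction, a time of excitation. -/
theorem PersistentlyExciting.exists_excited {u : ℝ → EuclideanSpace ℝ (Fin n)} {δ μ : ℝ}
    (hδ : 0 < δ) (hμ : 0 < μ) (hu : ContinuousOn u (Ici 0)) (h : PersistentlyExciting u δ μ)
    (x : EuclideanSpace ℝ (Fin n)) (t : ℝ) (ht : 0 ≤ t) :
    ∃ s ∈ Icc t (t + δ), √μ / 2 * ‖x‖ ≤ |inner ℝ (u s) x| := by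
  by_contra! hcon
  have htδ : t ≤ t + δ := by linarith
  have hx : 0 < ‖x‖ := by
    have := (abs_nonneg _).trans_lt (hcon t (left_mem_Icc.2 htδ))
    have hs : 0 < √μ := Real.sqrt_pos.2 hμ
    by_contra! h0
    nlinarith [norm_nonneg x]
  have hui : ∀ i, ContinuousOn (fun s => u s i) (uIcc t (t + δ)) := fun i =>
    ((EuclideanSpace.proj (𝕜 := ℝ) i).continuous.comp_continuousOn hu).mono (by
      rw [uIcc_of_le htδ]; exact fun s hs => ht.trans hs.1)
  have hin : ∀ s, inner ℝ (u s) x = ∑ i, u s i * x i := fun s => by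
    simp [PiLp.inner_apply, mul_comm]
  have hcont : ContinuousOn (fun s => inner ℝ (u s) x ^ 2) (uIcc t (t + δ)) := by
    simp only [hin]
    exact (continuousOn_finsetSum _ fun i _ => (hui i).mul continuousOn_const).pow 2
  have hint : ∑ i, ∑ j, x i * ((∫ s in t..(t + δ), u s i * u s j) * x j) =
      ∫ s in t..(t + δ), inner ℝ (u s) x ^ 2 := by
    have hterm : ∀ i j, IntervalIntegrable (fun s => x i * (u s i * u s j * x j)) volume t (t + δ) :=
      fun i j => (continuousOn_const.mul (((hui i).mul (hui j)).mul
        continuousOn_const)).intervalIntegrable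
    calc _ = ∑ i, ∑ j, ∫ s in t..(t + δ), x i * (u s i * u s j * x j) := by
          simp only [intervalIntegral.integral_const_mul, intervalIntegral.integral_mul_const]
      _ = ∑ i, ∫ s in t..(t + δ), ∑ j, x i * (u s i * u s j * x j) :=
          Finset.sum_congr rfl fun i _ =>
            (intervalIntegral.integral_finsetSum fun j _ => hterm i j).symm
      _ = ∫ s in t..(t + δ), ∑ i, ∑ j, x i * (u s i * u s j * x j) :=
          (intervalIntegral.integral_finsetSum fun i _ => by
            simpa only [Finset.sum_fn] using IntervalIntegrable.sum _ fun j _ => hterm i j).symm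
      _ = _ := by
          congr 1; ext s
          rw [hin, pow_two, Finset.sum_mul_sum]
          refine Finset.sum_congr rfl fun i _ => Finset.sum_congr rfl fun j _ => by ring
  -- Without an excited time the mean of `(u · x)²` is at most `μ/4 |x|²`, whereas excitation
  -- demands `μ |x|²`.
  have hle : ∫ s in t..(t + δ), inner ℝ (u s) x ^ 2 ≤ ∫ _s in t..(t + δ), μ / 4 * ‖x‖ ^ 2 := by
    refine intervalIntegral.integral_mono_on htδ hcont.intervalIntegrable
      (by simp) fun s hs => ?_
    have h1 := pow_le_pow_left₀ (abs_nonneg _) (hcon s hs).le 2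
    rw [sq_abs, mul_pow, div_pow, Real.sq_sqrt hμ.le] at h1
    linarith
  rw [intervalIntegral.integral_const, add_sub_cancel_left, smul_eq_mul] at hle
  have hps := (h t ht).dotProduct_mulVec_nonneg x.ofLp
  have hxx : x.ofLp ⬝ᵥ x.ofLp = ‖x‖ ^ 2 := by
    rw [EuclideanSpace.norm_sq_eq]
    simp [dotProduct, ← pow_two]
  rw [star_trivial, sub_mulVec, smul_mulVec, smul_mulVec, one_mulVec, dotProduct_sub,
    dotProduct_smul, dotProduct_smul, hxx, smul_eq_mul, smul_eq_mul] at hps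
  have hq : x.ofLp ⬝ᵥ (Matrix.of fun i j : Fin n => ∫ s in t..(t + δ), u s i * u s j) *ᵥ x.ofLp =
      ∫ s in t..(t + δ), inner ℝ (u s) x ^ 2 := by
    rw [← hint]
    simp only [dotProduct, Matrix.mulVec, Finset.mul_sum, of_apply]
  rw [hq] at hps
  have h2 : 1 / δ * ∫ s in t..(t + δ), inner ℝ (u s) x ^ 2 ≤ 1 / δ * (δ * (μ / 4 * ‖x‖ ^ 2)) := by
    gcongr
  have h3 : 1 / δ * (δ * (μ / 4 * ‖x‖ ^ 2)) = μ / 4 * ‖x‖ ^ 2 := by field_simp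
  have h4 : 0 < μ * ‖x‖ ^ 2 := by positivity
  linarith

end AugmentedState

/-! ### Uniform bounds for the Lyapunov solution. -/

section Observability

open scoped Matrix.Norms.Operator

variable {n : ℕ}

/-- A constant diagonal matrix `M` is a barrier above `R`. Its weight on `x` must exceed that on `y`
by an amount of order `B²` to absorb the coupling: at contact the derivative of `M - R` has form at
least `(|y| - 2 B |x|)² + 2 |x|²`. -/
theorem lyapunov_upper_bound {u : ℝ → EuclideanSpace ℝ (Fin n)} {B : ℝ}
    (hB : ∀ t, 0 ≤ t → ‖u t‖ ≤ B) {R : ℝ → Matrix (AugIdx n) (AugIdx n) ℝ} (hR0 : R 0 = 1)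
    (hRs : ∀ t, (R t)ᵀ = R t)
    (hR : ∀ t, 0 ≤ t → HasDerivWithinAt R (outputGram n 1 - R t - R t * stateMatrix (u t)
      - (stateMatrix (u t))ᵀ * R t) (Ici 0) t) (t : ℝ) (ht : 0 ≤ t) (v : AugIdx n → ℝ) :
    v ⬝ᵥ R t *ᵥ v ≤ (4 * B ^ 2 + 2) * (v ⬝ᵥ v) := by
  let d : AugIdx n → ℝ := Sum.elim (fun _ => 4 * B ^ 2 + 2) fun _ => 2
  let M : Matrix (AugIdx n) (AugIdx n) ℝ := diagonal d
  have hMv : ∀ w : AugIdx n → ℝ, w ⬝ᵥ M *ᵥ w =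
      (4 * B ^ 2 + 2) * ‖augPos w‖ ^ 2 + 2 * augOut w ^ 2 := fun w => by
    simp only [M, mulVec_diagonal, dotProduct, Fintype.sum_sum_type, d, Sum.elim_inl, Sum.elim_inr,
      EuclideanSpace.norm_sq_eq, augPos, augOut, Finset.mul_sum, Real.norm_eq_abs, sq_abs]
    simp only [Finset.univ_unique, Finset.sum_singleton]
    congr 1
    · exact Finset.sum_congr rfl fun i _ => by ring
    · change w (Sum.inr ()) * (2 * w (Sum.inr ())) = _; ring
  have hDs : ∀ t, 0 ≤ t → (M - R t)ᵀ = M - R t := fun t _ => by simp [M, hRs t]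
  have hpd := posDef_of_barrier hDs (fun t ht => (hR t ht).const_sub M) ?_ ?_ t ht
  · have h1 := hpd.posSemidef.dotProduct_mulVec_nonneg v
    rw [star_trivial, sub_mulVec, dotProduct_sub, hMv] at h1
    rw [aug_dotProduct_self]
    nlinarith [sq_nonneg B, sq_nonneg (augOut v), sq_nonneg (B * augOut v)]
  · rw [posDef_iff_real (hDs 0 le_rfl)]
    intro w hw
    have := dotProduct_self_pos hw
    rw [sub_mulVec, dotProduct_sub, hMv, hR0, one_mulVec]
    rw [aug_dotProduct_self] at *
    nlinarith [sq_nonneg (B * ‖augPos w‖), sq_nonneg ‖augPos w‖]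
  · intro s hs w hw _ hker
    have hRw : R s *ᵥ w = M *ᵥ w := by
      rw [sub_mulVec, sub_eq_zero] at hker
      exact hker.symm
    have hvv := dotProduct_self_pos hw
    have e1 : (M *ᵥ w) ⬝ᵥ stateMatrix (u s) *ᵥ w = 2 * augOut w * inner ℝ (u s) (augPos w) := by
      rw [dotProduct_stateMatrix_mulVec]
      simp [augOut, M, mulVec_diagonal, d]
    rw [neg_mulVec, dotProduct_neg, sub_mulVec, sub_mulVec, sub_mulVec, dotProduct_sub,
      dotProduct_sub, dotProduct_sub, dotProduct_mul_mulVec_of_symm (hRs s),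
      dotProduct_transpose_mul_mulVec, hRw, e1, hMv, dotProduct_outputGram_mulVec]
    rw [aug_dotProduct_self] at hvv
    have h1 : |inner ℝ (u s) (augPos w)| ≤ B * ‖augPos w‖ :=
      (abs_real_inner_le_norm _ _).trans (mul_le_mul_of_nonneg_right (hB s hs) (norm_nonneg _))
    have h2 : |augOut w * inner ℝ (u s) (augPos w)| ≤ |augOut w| * (B * ‖augPos w‖) := by
      rw [abs_mul]; gcongr
    have h3 := (abs_le.1 h2).1
    have h4 := sq_nonneg (|augOut w| - 2 * (B * ‖augPos w‖))
    have h5 := sq_abs (augOut w)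
    rcases eq_or_ne ‖augPos w‖ 0 with h0 | h0
    · rw [h0] at h3 hvv ⊢
      nlinarith
    · have : 0 < ‖augPos w‖ ^ 2 := by positivity
      nlinarith

/-- The quadratic form at time `t` and vector `v` is the final energy of the trajectory of `z' = A
z` that ends at `v`, so the scalar observability estimate applies with a constant independent of `t`
and `v`. -/
theorem lyapunov_lower_bound {u : ℝ → EuclideanSpace ℝ (Fin n)}
    (hu : UniformContinuousOn u (Ici 0)) {B : ℝ} (hB : ∀ t, 0 ≤ t → ‖u t‖ ≤ B) {δ μ : ℝ}
    (hδ : 0 < δ) (hμ : 0 < μ) (hpe : PersistentlyExciting u δ μ)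
    {R : ℝ → Matrix (AugIdx n) (AugIdx n) ℝ} (hR0 : R 0 = 1) (hRs : ∀ t, (R t)ᵀ = R t)
    (hR : ∀ t, 0 ≤ t → HasDerivWithinAt R (outputGram n 1 - R t - R t * stateMatrix (u t)
      - (stateMatrix (u t))ᵀ * R t) (Ici 0) t) :
    ∃ ρ : ℝ, 0 < ρ ∧ ∀ t, 0 ≤ t → ∀ v : AugIdx n → ℝ, ρ * (v ⬝ᵥ v) ≤ v ⬝ᵥ R t *ᵥ v := by
  have hB0 : 0 ≤ B := (norm_nonneg _).trans (hB 0 le_rfl)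
  have hκ : 0 < √μ / 4 := by have := Real.sqrt_pos.2 hμ; positivity
  obtain ⟨τ₀, hτ₀, hosc₀⟩ := Metric.uniformContinuousOn_iff_le.1 hu (√μ / 4) hκ
  let τ := min τ₀ δ
  have hτ : 0 < τ := lt_min hτ₀ hδ
  obtain ⟨K, hK, hmain⟩ := energy_lower_bound hB0 hδ hτ (min_le_right τ₀ δ) hκ
  have hm : Continuous fun t : ℝ => max t 0 := continuous_id.max continuous_const
  have hũ : Continuous fun t : ℝ => u (max t 0) :=
    hu.continuousOn.comp_continuous hm fun t => le_max_right t 0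
  refine ⟨1 / K, by positivity, fun t ht v => ?_⟩
  let x := augPos v
  have hg : Continuous fun s : ℝ => inner ℝ (u (max s 0)) x := hũ.inner continuous_const
  -- Integrating from the final time `t` imposes `z t = v`.
  let η : ℝ → ℝ := fun s => augOut v + ∫ r in t..s, inner ℝ (u (max r 0)) x
  have hη : ∀ s, 0 ≤ s → HasDerivWithinAt η (inner ℝ (u s) x) (Ici 0) s := fun s hs => by
    have := ((hg.integral_hasStrictDerivAt t s).hasDerivAt.const_add
      (augOut v)).hasDerivWithinAt (s := Ici 0)
    rwa [max_eq_left hs] at this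
  let z : ℝ → AugIdx n → ℝ := fun s => Sum.elim x fun _ => η s
  have hzx : ∀ s, augPos (z s) = x := fun s => rfl
  have hzη : ∀ s, augOut (z s) = η s := fun s => rfl
  have hz : ∀ s, 0 ≤ s → HasDerivWithinAt z (stateMatrix (u s) *ᵥ z s) (Ici 0) s := fun s hs => by
    refine hasDerivWithinAt_pi.2 fun i => ?_
    rw [stateMatrix_mulVec, hzx]
    rcases i with i | i
    · exact hasDerivWithinAt_const _ _ _
    · exact hη s hs
  let φ : ℝ → ℝ := fun s => Real.exp s * (z s ⬝ᵥ R s *ᵥ z s)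
  have hφ : ∀ s, 0 ≤ s → HasDerivWithinAt φ (Real.exp s * η s ^ 2) (Ici 0) s := fun s hs => by
    refine ((Real.hasDerivAt_exp s).hasDerivWithinAt.fun_mul
      ((hR s hs).quadForm (hz s hs) (hRs s))).congr_deriv ?_
    rw [sub_mulVec, sub_mulVec, sub_mulVec, dotProduct_sub, dotProduct_sub, dotProduct_sub,
      dotProduct_mul_mulVec_of_symm (hRs s), dotProduct_transpose_mul_mulVec,
      dotProduct_outputGram_mulVec, hzη, mulVec_mulVec, dotProduct_mul_mulVec_of_symm (hRs s)]
    ring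
  have hzt : z t = v := by
    ext i
    rcases i with i | i
    · rfl
    · simp [z, η, augOut]
  have h := hmain φ η (fun s => inner ℝ (u s) x) ‖x‖ t (norm_nonneg _) ht hφ hη
    (fun s hs => (abs_real_inner_le_norm _ _).trans
      (mul_le_mul_of_nonneg_right (hB s hs) (norm_nonneg _)))
    (fun s s' hs hs' hss => by
      rw [← inner_sub_left]
      refine (abs_real_inner_le_norm _ _).trans (mul_le_mul_of_nonneg_right ?_ (norm_nonneg _))
      rw [← dist_eq_norm]
      exact hosc₀ s hs s' hs' (hss.trans (min_le_left _ _)))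
    (fun s hs => by
      obtain ⟨r, hr, hr'⟩ := hpe.exists_excited hδ hμ hu.continuousOn x s hs
      exact ⟨r, hr, by linarith⟩)
    (by simp only [φ, hR0, one_mulVec, Real.exp_zero, one_mul, aug_dotProduct_self, hzx, hzη]
        exact le_rfl)
  have hηt : η t = augOut v := by simp [η]
  simp only [φ, hzt, hηt, x, ← aug_dotProduct_self] at h
  rw [one_div, inv_mul_le_iff₀ hK]
  refine le_of_mul_le_mul_left ?_ (Real.exp_pos t)
  linarith

end Observability

/-! ### The inverse Riccati equation and exponential decay. -/

section Information

open scoped Matrix.Norms.Operator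

theorem dotProduct_mulVec_le_of_abs_le {m : Type*} [Fintype m] {M : Matrix m m ℝ} {B : ℝ}
    (hM : ∀ i j, |M i j| ≤ B) (v : m → ℝ) :
    v ⬝ᵥ M *ᵥ v ≤ B * Fintype.card m * (v ⬝ᵥ v) := by
  have h1 : v ⬝ᵥ M *ᵥ v ≤ ∑ i, ∑ j, B * ((v i * v i + v j * v j) / 2) := by
    simp only [dotProduct, Matrix.mulVec, Finset.mul_sum]
    refine Finset.sum_le_sum fun i _ => Finset.sum_le_sum fun j _ => ?_
    have h2 : v i * (M i j * v j) ≤ |M i j| * (|v i| * |v j|) := by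
      refine (le_abs_self _).trans_eq ?_
      rw [abs_mul, abs_mul]; ring
    have h3 : |v i| * |v j| ≤ (v i * v i + v j * v j) / 2 := by
      have := sq_nonneg (|v i| - |v j|)
      have := abs_mul_abs_self (v i)
      have := abs_mul_abs_self (v j)
      nlinarith
    refine h2.trans (mul_le_mul (hM i j) h3 (by positivity) ((abs_nonneg _).trans (hM i j)))
  refine h1.trans_eq ?_
  simp only [← Finset.mul_sum, ← Finset.sum_div, Finset.sum_add_distrib, Finset.sum_const,
    Finset.card_univ, nsmul_eq_mul, dotProduct]
  rw [Finset.sum_congr rfl fun i _ => mul_left_comm (v i) _ (v i), ← Finset.mul_sum]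
  ring

theorem dotProduct_inv_mulVec_le {m : Type*} [Fintype m] {P Q : Matrix m m ℝ} [DecidableEq m]
    (hPQ : P * Q = 1) {p : ℝ} (hp : 0 < p)
    (hP : ∀ v : m → ℝ, p * (v ⬝ᵥ v) ≤ v ⬝ᵥ P *ᵥ v) (v : m → ℝ) :
    v ⬝ᵥ Q *ᵥ v ≤ 1 / p * (v ⬝ᵥ v) := by
  -- With `w = Qv`, this reads `p |w|² ≤ v · w`; combined with `|v - p w|² ≥ 0` it gives `p (v · w)
  -- ≤ |v|²`, with no symmetry needed.
  have h1 := hP (Q *ᵥ v)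
  rw [mulVec_mulVec, hPQ, one_mulVec] at h1
  have h2 := dotProduct_self_nonneg' (v - p • (Q *ᵥ v))
  simp only [dotProduct_sub, sub_dotProduct, dotProduct_smul, smul_dotProduct, smul_eq_mul] at h2
  rw [dotProduct_comm (Q *ᵥ v) v] at h1 h2
  rw [one_div, ← div_eq_inv_mul, le_div_iff₀ hp]
  have := mul_le_mul_of_nonneg_left h1 hp.le
  linarith

variable {m : Type*} [Fintype m] [DecidableEq m]

/-- Inversion exchanges the roles of `S` and `V`: the measurement term becomes the source, and the
source becomes the quadratic damping. -/
theorem riccati_inv_hasDerivWithinAt {A S V P : Matrix m m ℝ} {Pf : ℝ → Matrix m m ℝ} {t : ℝ}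
    (hPt : Pf t = P) (hu : IsUnit P)
    (h : HasDerivWithinAt Pf (A * P + P * Aᵀ - P * S * P + V) (Ici 0) t) :
    HasDerivWithinAt (fun s => (Pf s)⁻¹) (S - P⁻¹ * A - Aᵀ * P⁻¹ - P⁻¹ * V * P⁻¹) (Ici 0) t := by
  refine (h.matrix_inv (by rwa [hPt])).congr_deriv ?_
  rw [hPt]
  have hd := (isUnit_iff_isUnit_det _).1 hu
  have h1 : P * P⁻¹ = 1 := mul_nonsing_inv _ hd
  have h2 : P⁻¹ * P = 1 := nonsing_inv_mul _ hd
  generalize P⁻¹ = Q at *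
  calc _ = (Q * P) * S * (P * Q) - Q * A * (P * Q) - (Q * P) * Aᵀ * Q - Q * V * Q := by
        noncomm_ring
    _ = _ := by rw [h1, h2]; simp

theorem lyapunov_decay {L L' : ℝ → ℝ} {r : ℝ}
    (hL : ∀ t, 0 ≤ t → HasDerivWithinAt L (L' t) (Ici 0) t) (h : ∀ t, 0 ≤ t → L' t ≤ -r * L t)
    {t₀ t : ℝ} (ht₀ : 0 ≤ t₀) (ht : t₀ ≤ t) : L t ≤ Real.exp (-r * (t - t₀)) * L t₀ := by
  have hd : ∀ s, 0 ≤ s → HasDerivWithinAt (fun s => Real.exp (r * s) * L s)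
      (Real.exp (r * s) * (r * L s + L' s)) (Ici 0) s := fun s hs => by
    have h1 := (((hasDerivAt_id s).const_mul r).exp).hasDerivWithinAt (s := Ici 0)
    refine (h1.fun_mul (hL s hs)).congr_deriv ?_
    simp only [id]; ring
  have h1 := mul_sub_le_sub_of_le_hasDerivWithinAt (fun s hs => (hd s hs).fun_neg) ht₀ ht (c := 0)
    fun s hs => by
      have h2 := h s (ht₀.trans hs.1)
      have h3 := Real.exp_pos (r * s)
      nlinarith
  have h4 : Real.exp (r * t) * L t ≤ Real.exp (r * t₀) * L t₀ := by linarith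
  have h5 := mul_le_mul_of_nonneg_left h4 (Real.exp_pos (-(r * t))).le
  rw [← mul_assoc, ← mul_assoc, ← Real.exp_add, ← Real.exp_add, neg_add_cancel, Real.exp_zero,
    one_mul] at h5
  rwa [show -r * (t - t₀) = -(r * t) + r * t₀ by ring]

end Information

/-! ### Error dynamics and convergence of the observer. -/

section Observer

open scoped Matrix.Norms.Operator

variable {n : ℕ} {u : ℝ → EuclideanSpace ℝ (Fin n)} {q k : ℝ → ℝ}
  {V P : ℝ → Matrix (AugIdx n) (AugIdx n) ℝ} {P₀ : Matrix (AugIdx n) (AugIdx n) ℝ}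

theorem isRiccatiSolution_iff : IsRiccatiSolution u q V P₀ P ↔ P 0 = P₀ ∧ ∀ t, 0 ≤ t →
    HasDerivWithinAt P (stateMatrix (u t) * P t + P t * (stateMatrix (u t))ᵀ
      - P t * outputGram n (q t) * P t + V t) (Ici 0) t := by
  simp only [IsRiccatiSolution, hasDerivWithinAt_matrix_iff, outputGram, Matrix.mul_assoc]

theorem IsRiccatiSolution.continuousOn (hP : IsRiccatiSolution u q V P₀ P) :
    ContinuousOn P (Ici 0) :=
  continuousOn_pi.2 fun i => continuousOn_pi.2 fun j => fun t ht =>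
    (hP.2 t ht i j).continuousWithinAt

theorem augState_hasDerivWithinAt {x : ℝ → EuclideanSpace ℝ (Fin n)}
    (hx : IsPositionTrajectory u x) {t : ℝ} (ht : 0 ≤ t) :
    HasDerivWithinAt (fun s => (augState (x s)).ofLp)
      (stateMatrix (u t) *ᵥ (augState (x t)).ofLp + augInput (u t)) (Ici 0) t := by
  refine hasDerivWithinAt_pi.2 fun i => ?_
  rw [stateMatrix_mulVec]
  rcases i with i | i
  · have := (EuclideanSpace.proj (𝕜 := ℝ) i).hasFDerivAt.comp_hasDerivWithinAt t (hx t ht)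
    refine this.congr_deriv ?_
    simp [augInput]
  · refine ((hx t ht).norm_sq.const_mul (1 / 2 : ℝ)).congr_deriv ?_
    have : augPos (augState (x t)).ofLp = x t := rfl
    simp only [Pi.add_apply, Sum.elim_inr, augInput, this, add_zero]
    rw [real_inner_comm]; ring

/-- The input cancels, and the innovation `y - C X'` is the last component of the error because `y`
is itself a state; this is why the error equation is linear. -/
theorem estimationError_hasDerivWithinAt {x : ℝ → EuclideanSpace ℝ (Fin n)}
    {X' : ℝ → EuclideanSpace ℝ (AugIdx n)} (hx : IsPositionTrajectory u x)
    (hX : IsObserverTrajectory u q k P x X') {t : ℝ} (ht : 0 ≤ t) :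
    HasDerivWithinAt (fun s => (augState (x s) - X' s).ofLp)
      (stateMatrix (u t) *ᵥ (augState (x t) - X' t).ofLp - (k t * q t *
        augOut (augState (x t) - X' t).ofLp) • (P t *ᵥ (outputMatrix n)ᵀ *ᵥ fun _ => 1))
      (Ici 0) t := by
  have h1 := (EuclideanSpace.equiv (AugIdx n) ℝ).hasFDerivAt.comp_hasDerivWithinAt t (hX t ht)
  refine ((augState_hasDerivWithinAt hx ht).fun_sub h1).congr_deriv ?_
  have h2 : (fun _ : Unit => rangeOutput (x t)) - outputMatrix n *ᵥ (X' t).ofLp =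
      augOut (augState (x t) - X' t).ofLp • fun _ => (1 : ℝ) := by
    rw [outputMatrix_mulVec]
    ext; simp [augOut, augState]
  rw [h2]
  change _ - (stateMatrix (u t) *ᵥ (X' t).ofLp + augInput (u t) + _) = _
  rw [observerGain, mulVec_smul, smul_mulVec, ← mulVec_mulVec, WithLp.ofLp_sub, mulVec_sub,
    smul_smul, mul_comm (augOut _)]
  abel

theorem exists_observer_trajectory (hu : ContinuousOn u (Ici 0)) (hq : ContinuousOn q (Ici 0))
    (hk : ContinuousOn k (Ici 0)) (hP : ContinuousOn P (Ici 0)) (x₀ : EuclideanSpace ℝ (Fin n))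
    (X₀ : EuclideanSpace ℝ (AugIdx n)) :
    ∃ (x : ℝ → EuclideanSpace ℝ (Fin n)) (X' : ℝ → EuclideanSpace ℝ (AugIdx n)),
      x 0 = x₀ ∧ X' 0 = X₀ ∧ IsPositionTrajectory u x ∧ IsObserverTrajectory u q k P x X' := by
  obtain ⟨x, hx0, hx⟩ := exists_forall_hasDerivWithinAt_linear
    (continuousOn_const (c := (0 : EuclideanSpace ℝ (Fin n) →L[ℝ] EuclideanSpace ℝ (Fin n)))) hu x₀
  have hx' : IsPositionTrajectory u x := fun t ht => by simpa using hx t ht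
  have hxc : ContinuousOn x (Ici 0) := fun t ht => (hx' t ht).continuousWithinAt
  have hK : ContinuousOn (fun t => observerGain (k t) (q t) (P t)) (Ici 0) :=
    (hk.mul hq).smul ((continuous_id.matrix_mul continuous_const :
      Continuous fun M : Matrix (AugIdx n) (AugIdx n) ℝ => M * (outputMatrix n)ᵀ).comp_continuousOn
        hP)
  -- Once `x` is known, the observer is linear in its state: `F = A - K C`, with the measurement in
  -- the forcing term.
  let F : ℝ → Matrix (AugIdx n) (AugIdx n) ℝ := fun t =>
    stateMatrix (u t) - observerGain (k t) (q t) (P t) * outputMatrix n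
  have hF : ContinuousOn F (Ici 0) := (continuousOn_stateMatrix hu).sub
    ((continuous_id.matrix_mul continuous_const :
      Continuous fun M : Matrix (AugIdx n) Unit ℝ => M * outputMatrix n).comp_continuousOn hK)
  let b : ℝ → EuclideanSpace ℝ (AugIdx n) := fun t => WithLp.toLp 2
    (augInput (u t) + observerGain (k t) (q t) (P t) *ᵥ fun _ => rangeOutput (x t))
  have hb : ContinuousOn b (Ici 0) := by
    refine (PiLp.continuous_toLp 2 _).comp_continuousOn (continuousOn_pi.2 fun i => ?_)
    refine ContinuousOn.add ?_ ?_
    · rcases i with i | i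
      · exact (EuclideanSpace.proj (𝕜 := ℝ) i).continuous.comp_continuousOn hu
      · exact continuousOn_const
    · simp only [Matrix.mulVec, dotProduct]
      exact continuousOn_finsetSum _ fun j _ =>
        (continuousOn_pi.1 (continuousOn_pi.1 hK i) j).mul (continuousOn_const.mul (hxc.norm.pow 2))
  have hL : ContinuousOn (fun t => Matrix.toEuclideanCLM (𝕜 := ℝ) (F t)) (Ici 0) :=
    ((Matrix.toEuclideanCLM (𝕜 := ℝ) (n := AugIdx n)).toAlgEquiv.toLinearMap
      |>.continuous_of_finiteDimensional).comp_continuousOn hF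
  obtain ⟨X', hX0, hX⟩ := exists_forall_hasDerivWithinAt_linear hL hb X₀
  refine ⟨x, X', hx0, hX0, hx', fun t ht => (hX t ht).congr_deriv ?_⟩
  ext i
  simp only [F, b, PiLp.add_apply, Matrix.ofLp_toEuclideanCLM, sub_mulVec, ← mulVec_mulVec,
    mulVec_sub, Pi.add_apply, Pi.sub_apply]
  ring

/-- The form `eᵀQe` decays at rate `ε α`. The bounds `α`, `β` convert it to the norm, and the square
root yields the overshoot `√(β / α)` and half the rate. -/
theorem observer_error_bound {Q : ℝ → Matrix (AugIdx n) (AugIdx n) ℝ} {ε α β : ℝ}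
    (hε : 0 < ε) (hα : 0 < α) (hβ : 0 < β) (hq : ∀ t, 0 ≤ t → 0 ≤ q t)
    (hk : ∀ t, 0 ≤ t → 1 / 2 ≤ k t)
    (hV : ∀ t, 0 ≤ t → ∀ v : AugIdx n → ℝ, ε * (v ⬝ᵥ v) ≤ v ⬝ᵥ V t *ᵥ v)
    (hQs : ∀ t, 0 ≤ t → (Q t)ᵀ = Q t) (hQP : ∀ t, 0 ≤ t → Q t * P t = 1)
    (hQ : ∀ t, 0 ≤ t → HasDerivWithinAt Q (outputGram n (q t) - Q t * stateMatrix (u t)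
      - (stateMatrix (u t))ᵀ * Q t - Q t * V t * Q t) (Ici 0) t)
    (hQl : ∀ t, 0 ≤ t → ∀ v : AugIdx n → ℝ, α * (v ⬝ᵥ v) ≤ v ⬝ᵥ Q t *ᵥ v)
    (hQu : ∀ t, 0 ≤ t → ∀ v : AugIdx n → ℝ, v ⬝ᵥ Q t *ᵥ v ≤ β * (v ⬝ᵥ v))
    {x : ℝ → EuclideanSpace ℝ (Fin n)} {X' : ℝ → EuclideanSpace ℝ (AugIdx n)}
    (hx : IsPositionTrajectory u x) (hX : IsObserverTrajectory u q k P x X') {t₀ t : ℝ}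
    (ht₀ : 0 ≤ t₀) (ht : t₀ ≤ t) :
    ‖augState (x t) - X' t‖ ≤
      √(β / α) * Real.exp (-(ε * α / 2) * (t - t₀)) * ‖augState (x t₀) - X' t₀‖ := by
  let e : ℝ → AugIdx n → ℝ := fun s => (augState (x s) - X' s).ofLp
  let L : ℝ → ℝ := fun s => e s ⬝ᵥ Q s *ᵥ e s
  have hnorm : ∀ s, e s ⬝ᵥ e s = ‖augState (x s) - X' s‖ ^ 2 := fun s => by
    rw [EuclideanSpace.norm_sq_eq]
    simp [e, dotProduct, ← pow_two]
  have hL : ∀ s, 0 ≤ s → HasDerivWithinAt L ((1 - 2 * k s) * (q s * augOut (e s) ^ 2)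
      - (Q s *ᵥ e s) ⬝ᵥ V s *ᵥ (Q s *ᵥ e s)) (Ici 0) s := fun s hs => by
    refine ((hQ s hs).quadForm (estimationError_hasDerivWithinAt hx hX hs)
      (hQs s hs)).congr_deriv ?_
    change e s ⬝ᵥ _ *ᵥ e s + 2 * (e s ⬝ᵥ Q s *ᵥ (stateMatrix (u s) *ᵥ e s -
      (k s * q s * augOut (e s)) • (P s *ᵥ (outputMatrix n)ᵀ *ᵥ fun _ => 1))) = _
    have h1 : e s ⬝ᵥ Q s *ᵥ (P s *ᵥ (outputMatrix n)ᵀ *ᵥ fun _ => 1) = augOut (e s) := by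
      rw [mulVec_mulVec, hQP s hs, one_mulVec, Matrix.dotProduct_transpose_mulVec,
        outputMatrix_mulVec]
      simp [dotProduct]
    rw [mulVec_sub, dotProduct_sub, mulVec_smul, dotProduct_smul, h1, sub_mulVec, sub_mulVec,
      sub_mulVec, dotProduct_sub, dotProduct_sub, dotProduct_sub, dotProduct_outputGram_mulVec,
      mul_assoc (Q s), dotProduct_mul_mulVec_of_symm (hQs s hs) (e s) (e s) (N := V s * Q s),
      dotProduct_transpose_mul_mulVec, mulVec_mulVec, ← mulVec_mulVec _ (V s),
      dotProduct_mul_mulVec_of_symm (hQs s hs), smul_eq_mul]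
    ring
  have hdecay := lyapunov_decay hL (r := ε * α) (fun s hs => by
    have h1 := hV s hs (Q s *ᵥ e s)
    have h2 : (1 - 2 * k s) * (q s * augOut (e s) ^ 2) ≤ 0 :=
      mul_nonpos_of_nonpos_of_nonneg (by linarith [hk s hs])
        (mul_nonneg (hq s hs) (sq_nonneg _))
    -- This gives `|Qe|² ≥ 2 α eᵀQe - α² |e|² ≥ α eᵀQe`, using `α |e|² ≤ eᵀQe`.
    have h3 := dotProduct_self_nonneg' (Q s *ᵥ e s - α • e s)
    simp only [dotProduct_sub, sub_dotProduct, dotProduct_smul, smul_dotProduct,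
      smul_eq_mul] at h3
    rw [dotProduct_comm (Q s *ᵥ e s) (e s)] at h3
    have h4 := mul_le_mul_of_nonneg_left (hQl s hs (e s)) hα.le
    have h5 : α * L s ≤ (Q s *ᵥ e s) ⬝ᵥ (Q s *ᵥ e s) := by simp only [L]; linarith
    have h6 := mul_le_mul_of_nonneg_left h5 hε.le
    linarith) ht₀ ht
  have h1 := hQl t (ht₀.trans ht) (e t)
  have h2 := hQu t₀ ht₀ (e t₀)
  rw [hnorm] at h1 h2
  refine le_of_sq_le_sq ?_ (by positivity)
  rw [mul_pow, mul_pow, Real.sq_sqrt (by positivity), ← Real.exp_nat_mul,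
    show ((2 : ℕ) : ℝ) * (-(ε * α / 2) * (t - t₀)) = -(ε * α) * (t - t₀) by push_cast; ring,
    div_mul_eq_mul_div, div_mul_eq_mul_div, le_div_iff₀ hα]
  have h3 := mul_le_mul_of_nonneg_left h2 (Real.exp_pos (-(ε * α) * (t - t₀))).le
  simp only [L] at hdecay
  linarith

end Observer

/-! ### Assembly of the bounds. -/

theorem mainTheorem3 (n : ℕ) (u : ℝ → EuclideanSpace ℝ (Fin n))
    (hu_cont : UniformContinuousOn u (Ici 0))
    (hu_bdd : ∃ B : ℝ, ∀ t : ℝ, 0 ≤ t → ‖u t‖ ≤ B)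
    (hu_pe : ∃ δ μ : ℝ, 0 < δ ∧ 0 < μ ∧ PersistentlyExciting u δ μ)
    (ε : ℝ) (hε : 0 < ε)
    (q : ℝ → ℝ) (hq_cont : ContinuousOn q (Ici 0))
    (hq_bdd : ∃ B : ℝ, ∀ t : ℝ, 0 ≤ t → q t ≤ B)
    (hq_pos : ∀ t : ℝ, 0 ≤ t → ε ≤ q t)
    (V : ℝ → Matrix (AugIdx n) (AugIdx n) ℝ) (hV_cont : ContinuousOn V (Ici 0))
    (hV_bdd : ∃ B : ℝ, ∀ t : ℝ, 0 ≤ t → ∀ i j : AugIdx n, |V t i j| ≤ B)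
    (hV_pos : ∀ t : ℝ, 0 ≤ t → (V t - ε • (1 : Matrix (AugIdx n) (AugIdx n) ℝ)).PosSemidef)
    (k : ℝ → ℝ) (hk_cont : ContinuousOn k (Ici 0))
    (hk : ∀ t : ℝ, 0 ≤ t → 1 / 2 ≤ k t)
    (P₀ : Matrix (AugIdx n) (AugIdx n) ℝ) (hP₀ : P₀.PosDef) :
    (∃ P : ℝ → Matrix (AugIdx n) (AugIdx n) ℝ, IsRiccatiSolution u q V P₀ P) ∧
    ∀ P : ℝ → Matrix (AugIdx n) (AugIdx n) ℝ, IsRiccatiSolution u q V P₀ P →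
      GloballyExponentiallyStabilizes u q k P := by
  obtain ⟨B, hB⟩ := hu_bdd
  obtain ⟨δ, μ, hδ, hμ, hpe⟩ := hu_pe
  obtain ⟨Bq, hBq⟩ := hq_bdd
  obtain ⟨BV, hBV⟩ := hV_bdd
  have hB0 : 0 ≤ B := (norm_nonneg _).trans (hB 0 le_rfl)
  have hBq0 : 0 ≤ Bq := (hε.le.trans (hq_pos 0 le_rfl)).trans (hBq 0 le_rfl)
  -- The output index exists even for `n = 0`.
  have hBV0 : 0 ≤ BV := (abs_nonneg _).trans (hBV 0 le_rfl (Sum.inr ()) (Sum.inr ()))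
  have hu := hu_cont.continuousOn
  have hA := continuousOn_stateMatrix hu
  have hS := continuousOn_outputGram (n := n) hq_cont
  have hq0 : ∀ t, 0 ≤ t → 0 ≤ q t := fun t ht => hε.le.trans (hq_pos t ht)
  have hVl : ∀ t, 0 ≤ t → ∀ v : AugIdx n → ℝ, ε * (v ⬝ᵥ v) ≤ v ⬝ᵥ V t *ᵥ v := fun t ht v => by
    have h := (hV_pos t ht).dotProduct_mulVec_nonneg v
    rw [star_trivial, sub_mulVec, dotProduct_sub, smul_mulVec, one_mulVec, dotProduct_smul,
      smul_eq_mul] at h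
    linarith
  have hVs : ∀ t, 0 ≤ t → (V t)ᵀ = V t := fun t ht => by
    have h : (V t - ε • (1 : Matrix (AugIdx n) (AugIdx n) ℝ))ᵀ = V t - ε • 1 := by
      simpa [IsHermitian] using (hV_pos t ht).isHermitian
    simpa using h
  refine ⟨?_, fun P hP => ?_⟩
  · obtain ⟨P, hP⟩ := exists_riccati_solution hA hS hV_cont
      (fun t ht v => by
        rw [dotProduct_outputGram_mulVec]
        exact mul_nonneg (hq0 t ht) (sq_nonneg _))
      (fun t ht v => le_trans (mul_nonneg hε.le (dotProduct_self_nonneg' v)) (hVl t ht v)) hP₀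
    exact ⟨P, isRiccatiSolution_iff.2 hP⟩
  obtain ⟨hP0, hPd⟩ := isRiccatiSolution_iff.1 hP
  have hPpos : (P 0).PosDef := hP0 ▸ hP₀
  have hPs := riccati_symm hA hS (fun t _ => outputGram_transpose (q t)) hVs
    (by simpa [IsHermitian] using hPpos.isHermitian) hPd
  obtain ⟨p, hp, hPl⟩ := riccati_lower_bound hB0 hBq0 hε
    (fun t ht => abs_dotProduct_stateMatrix_le (hB t ht))
    (fun t ht v => by
      rw [dotProduct_outputGram_mulVec, aug_dotProduct_self]
      have := mul_le_mul_of_nonneg_right (hBq t ht) (sq_nonneg (augOut v))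
      nlinarith [mul_nonneg hBq0 (sq_nonneg ‖augPos v‖)]) hVl hPs hPpos hPd
  have hPpd : ∀ t, 0 ≤ t → (P t).PosDef := fun t ht => (posDef_iff_real (hPs t ht)).2 fun v hv =>
    lt_of_lt_of_le (mul_pos hp (dotProduct_self_pos hv)) (hPl t ht v)
  have hQs : ∀ t, 0 ≤ t → ((P t)⁻¹)ᵀ = (P t)⁻¹ := fun t ht => by
    rw [transpose_nonsing_inv, hPs t ht]
  have hQd := fun t ht => riccati_inv_hasDerivWithinAt rfl (hPpd t ht).isUnit (hPd t ht)
  obtain ⟨R, hR0, hRs, hR⟩ := exists_lyapunov_solution hA (outputGram_transpose (n := n) 1)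
  obtain ⟨ρ, hρ, hRl⟩ := lyapunov_lower_bound hu_cont hB hδ hμ hpe hR0 hRs hR
  obtain ⟨α, hα, hQl⟩ := information_lower_bound (b := BV * Fintype.card (AugIdx n))
    (Q := fun t => (P t)⁻¹) (by positivity) hε hρ (by positivity : 0 < 4 * B ^ 2 + 2)
    (fun t ht v => by
      rw [dotProduct_outputGram_mulVec, dotProduct_outputGram_mulVec, one_mul]
      exact mul_le_mul_of_nonneg_right (hq_pos t ht) (sq_nonneg _))
    (fun v => by rw [dotProduct_outputGram_mulVec, one_mul]; exact sq_nonneg _)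
    (fun t ht => dotProduct_mulVec_le_of_abs_le (hBV t ht)) hQs hPpos.inv hQd
    (fun t _ => hRs t) hR hRl (lyapunov_upper_bound hB hR0 hRs hR)
  have hdet : ∀ t, 0 ≤ t → IsUnit (P t).det := fun t ht =>
    (isUnit_iff_isUnit_det _).1 (hPpd t ht).isUnit
  refine ⟨exists_observer_trajectory hu hq_cont hk_cont hP.continuousOn,
    √(1 / p / α), ε * α / 2, by positivity, by positivity, fun x X' hx hX t₀ t ht₀ ht => ?_⟩
  exact observer_error_bound hε hα (by positivity) hq0 hk hVl hQs
    (fun t ht => nonsing_inv_mul _ (hdet t ht)) hQd hQl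
    (fun t ht => dotProduct_inv_mulVec_le (mul_nonsing_inv _ (hdet t ht)) hp (hPl t ht))
    hx hX ht₀ ht
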